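/- **Setting.** Let $d\ge 1$, $I=[0,1]$. A copula on $\mathbb{R}^d$ is the cdf of a probability measure on $\mathbb{R}^d$ all of whose one-dimensional marginals are uniform on $I$; we identify a copula with this measure. It is symmetric if it is invariant under permutations of the coordinates, and absolutely continuous if it has a density with respect to Lebesgue measure. For $u\in\mathbb{R}^d$ let $u_{(1)}\le\dots\le u_{(d)}$ be its coordinates in non-decreasing order. The multidiagonal of a copula $C$ is $\delta_C=(\delta_{(1)},\dots,\delta_{(d)})$, where $\delta_{(i)}(t)=\mathbb{P}(U_{(i)}\le t)$ and $U$ has cdf $C$. Let $\mathcal{D}$ be the set of multidiagonals of copulas, $\mathcal{D}^0\subset\mathcal{D}$ the set of multidiagonals of absolutely continuous copulas, and, for $\delta\in\mathcal{D}$, $\mathcal{C}_\delta$ the set of copulas with multidiagonal $\delta$. The entropy $H(C)\in[-\infty,+\infty)$ of a copula $C$ is $-\int c\log c$ if $C$ has density $c$, and $-\infty$ if $C$ is not absolutely continuous. For $\delta\in\mathcal{D}$ let $$J(\delta)=\sum_{i=2}^d\int_{\mathbb{R}}\bigl|\log\bigl(\delta_{(i-1)}(t)-\delta_{(i)}(t)\bigr)\bigr|\,\delta_{(i)}(dt)\in[0,+\infty],\qquad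 |\log 0|=+\infty .$$ Put $\delta_{(0)}=1$ and let $\Psi_i=\{s:\delta_{(i-1)}(s)>\delta_{(i)}(s)\}$ for $2\le i\le d$, $\Psi_1=(0,d_1)$ with $d_1=\inf\{s\in I:\delta_{(1)}(s)=1\}$, and $\Psi_{d+1}=(g_{d+1},1)$ with $g_{d+1}=\sup\{s\in I:\delta_{(d)}(s)=0\}$. These are open subsets of $I$. For $1\le i\le d$ and $t\in\Psi_i$ let $$K_i(t)=\int_{m_i(t)}^t\frac{\delta_{(i)}'(s)}{\delta_{(i-1)}(s)-\delta_{(i)}(s)}\,ds,$$ where $m_1(t)=0$ and, for $i\ge2$, $m_i(t)$ is the midpoint of the connected component of $\Psi_i$ that contains $t$; put $K_{d+1}=0$. Let $$a_i(t)=K_i'(t)\,e^{K_{i+1}(t)-K_i(t)}\,\mathbf{1}_{\Psi_i\cap\Psi_{i+1}}(t),\qquad c_\delta(u)=\frac1{d!}\,\mathbf{1}_{L_\delta}(u)\prod_{i=1}^d a_i(u_{(i)}),$$ where $L_\delta=\{u\in I^d:(u_{(i-1)},u_{(i)})\subset\Psi_i\text{ for all }2\le i\le d\}$, and let $C_\delta$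 be the measure on $\mathbb{R}^d$ with density $c_\delta$ (extended by $0$ outside $I^d$). **Theorem.** Let $\delta\in\mathcal{D}$. (a) If $J(\delta)=+\infty$, then $\max_{C\in\mathcal{C}_\delta}H(C)=-\infty$, that is, every copula with multidiagonal $\delta$ has entropy $-\infty$. (b) If $J(\delta)<+\infty$, then $\delta\in\mathcal{D}^0$, the function $c_\delta$ is non-negative and is the density of a symmetric absolutely continuous copula $C_\delta\in\mathcal{C}_\delta$, $\max_{C\in\mathcal{C}_\delta}H(C)>-\infty$, and $C_\delta$ is the unique copula in $\mathcal{C}_\delta$ with $H(C_\delta)=\max_{C\in\mathcal{C}_\delta}H(C)$. -/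

import Mathlib

open MeasureTheory Set
open scoped ENNReal Nat

noncomputable section

namespace MultidiagCopula

/-! Throughout, a cumulative distribution function on `ℝ^d` is represented by the law on
`Fin d → ℝ` of which it is the cumulative distribution function. -/

/-- The vector of order statistics of `u`: the coordinates of `u` in non-decreasing order. -/
def orderStat {d : ℕ} (u : Fin d → ℝ) : Fin d → ℝ := u ∘ Tuple.sort u

/-- `C` is (the law of) a copula: a probability measure on `ℝ^d` all of whose one-dimensional
marginals are uniform on `[0, 1]`. -/
structure IsCopula {d : ℕ} (C : Measure (Fin d → ℝ)) : Prop where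
  isProbabilityMeasure : IsProbabilityMeasure C
  map_eval : ∀ i, C.map (fun u => u i) = volume.restrict (Icc (0 : ℝ) 1)

/-- `C` is symmetric: it is invariant under permutations of the coordinates. -/
def IsSymmetric {d : ℕ} (C : Measure (Fin d → ℝ)) : Prop :=
  ∀ π : Equiv.Perm (Fin d), C.map (fun u => u ∘ π) = C

/-- The copulas with multidiagonal `δ`: for `U` with law `C`, the function `δ i` is the cumulative
distribution function of the order statistic of index `i` of `U`. -/
def copulasWith {d : ℕ} (δ : Fin d → StieltjesFunction ℝ) : Set (Measure (Fin d → ℝ)) :=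
  {C | IsCopula C ∧ ∀ i t, δ i t = C.real {u | orderStat u i ≤ t}}

/-- The set of multidiagonals of copulas on `ℝ^d`. -/
def multidiagonals (d : ℕ) : Set (Fin d → StieltjesFunction ℝ) :=
  {δ | ∃ C, C ∈ copulasWith δ}

/-- The set of multidiagonals of absolutely continuous copulas on `ℝ^d`. -/
def multidiagonalsAC (d : ℕ) : Set (Fin d → StieltjesFunction ℝ) :=
  {δ | ∃ C, C ∈ copulasWith δ ∧ C ≪ volume}

open Classical in
/-- Shannon entropy: `-∫ f log f` if `P` has a density `f` with respect to Lebesgue measure, and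
`-∞` otherwise. The integral of `-f log f` is taken in the extended reals, as the integral of its
positive part minus the integral of its negative part. -/
def entropy {d : ℕ} (P : Measure (Fin d → ℝ)) : EReal :=
  if P ≪ volume then
    ((∫⁻ x, ENNReal.ofReal (Real.negMulLog (P.rnDeriv volume x).toReal) : ℝ≥0∞) : EReal)
      - ((∫⁻ x, ENNReal.ofReal (-Real.negMulLog (P.rnDeriv volume x).toReal) : ℝ≥0∞) : EReal)
  else ⊥

/-- `δ` with one-based index and the conventions `δ_(0) = 1` and `δ_(d+1) = 0`; that is,
`ext δ k` is `δ_(k)`, which is `δ i` for `k = i + 1`. -/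
def ext {d : ℕ} (δ : Fin d → StieltjesFunction ℝ) (k : ℕ) (t : ℝ) : ℝ :=
  if k = 0 then 1 else if h : k - 1 < d then δ ⟨k - 1, h⟩ t else 0

open Classical in
/-- `|log x|` for `x ≥ 0`, with value `+∞` at `x = 0`. -/
def absLog (x : ℝ) : ℝ≥0∞ := if x = 0 then ⊤ else ENNReal.ofReal |Real.log x|

/-- `J(δ) = ∑_{k=2}^d ∫ |log (δ_(k-1)(t) - δ_(k)(t))| δ_(k)(dt)`. The term of index `i : Fin d` is
the one with `k = i + 1`. -/
def J {d : ℕ} (δ : Fin d → StieltjesFunction ℝ) : ℝ≥0∞ :=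
  ∑ i : Fin d with 0 < i.val,
    ∫⁻ t, absLog (ext δ i.val t - ext δ (i.val + 1) t) ∂(δ i).measure

/-- The open sets `Ψ_k`, for `1 ≤ k ≤ d + 1`: `Ψ_1 = (0, d_1)` where
`d_1 = inf {s ∈ [0, 1] : δ_(1)(s) = 1}`, then `Ψ_{d+1} = (g_{d+1}, 1)` where
`g_{d+1} = sup {s ∈ [0, 1] : δ_(d)(s) = 0}`, and `Ψ_k = {δ_(k-1) > δ_(k)}` for `2 ≤ k ≤ d`. -/
def Psi {d : ℕ} (δ : Fin d → StieltjesFunction ℝ) (k : ℕ) : Set ℝ :=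
  if k = 1 then Ioo 0 (sInf {s ∈ Icc (0 : ℝ) 1 | ext δ 1 s = 1})
  else if k = d + 1 then Ioo (sSup {s ∈ Icc (0 : ℝ) 1 | ext δ d s = 0}) 1
  else {s | ext δ k s < ext δ (k - 1) s}

/-- The lower bound of integration in `K_k(t)`: it is `0` if `k = 1`, and otherwise the midpoint of
the maximal open interval `(g, d)` contained in `Ψ_k` to which `t` belongs. -/
def mid {d : ℕ} (δ : Fin d → StieltjesFunction ℝ) (k : ℕ) (t : ℝ) : ℝ :=
  if k = 1 then 0
  else (sInf (ordConnectedComponent (Psi δ k) t) + sSup (ordConnectedComponent (Psi δ k) t)) / 2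

/-- `K_k(t) = ∫_m^t δ_(k)'(s) / (δ_(k-1)(s) - δ_(k)(s)) ds` for `1 ≤ k ≤ d` and `t ∈ Ψ_k`, and
`K_{d+1} = 0`. -/
def K {d : ℕ} (δ : Fin d → StieltjesFunction ℝ) (k : ℕ) (t : ℝ) : ℝ :=
  if k = d + 1 then 0
  else ∫ s in (mid δ k t)..t, deriv (ext δ k) s / (ext δ (k - 1) s - ext δ k s)

/-- `a_k(t) = K_k'(t) exp (K_{k+1}(t) - K_k(t))` on `Ψ_k ∩ Ψ_{k+1}`, and `0` elsewhere. -/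
def a {d : ℕ} (δ : Fin d → StieltjesFunction ℝ) (k : ℕ) : ℝ → ℝ :=
  (Psi δ k ∩ Psi δ (k + 1)).indicator
    (fun t => deriv (K δ k) t * Real.exp (K δ (k + 1) t - K δ k t))

/-- The set `L_δ` of the `u ∈ [0, 1]^d` with `(u_(k-1), u_(k)) ⊆ Ψ_k` for all `2 ≤ k ≤ d`. Here the
indices `i`, `j` of `Fin d` are those of `u_(k-1)` and `u_(k)`, so `k = j + 1`. -/
def L {d : ℕ} (δ : Fin d → StieltjesFunction ℝ) : Set (Fin d → ℝ) :=
  {u | (∀ i, u i ∈ Icc (0 : ℝ) 1) ∧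
    ∀ i j : Fin d, i.val + 1 = j.val →
      Ioo (orderStat u i) (orderStat u j) ⊆ Psi δ (j.val + 1)}

/-- The function `c_δ(u) = (1 / d!) 1_{L_δ}(u) ∏_{k=1}^d a_k(u_(k))`. -/
def density {d : ℕ} (δ : Fin d → StieltjesFunction ℝ) : (Fin d → ℝ) → ℝ :=
  (L δ).indicator (fun u => (1 / (d ! : ℝ)) * ∏ i : Fin d, a δ (i.val + 1) (orderStat u i))

/-- The measure `C_δ` with density `c_δ`. -/
def maxEntCopula {d : ℕ} (δ : Fin d → StieltjesFunction ℝ) : Measure (Fin d → ℝ) :=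
  volume.withDensity (fun u => ENNReal.ofReal (density δ u))

end MultidiagCopula

end

open Filter Topology NNReal

namespace MultidiagCopula

/-! ### Sorting and Lebesgue measure. -/

section OrderStatistics

variable {d : ℕ}

/-! The candidate `C_δ` makes the order statistics a Markov chain, and the logarithm of its density
has the same integral against every copula with multidiagonal `δ`. Gibbs' inequality then gives both
maximality and uniqueness.

Chain. The laws of the order statistics sum to `d` times the uniform law (`sum_measure`), so every
`δ_(k)` is Lipschitz. For consecutive `E = δ_(k-1)` and `F = δ_(k)`, put `G = E - F`, `h = F' / G`
and let `K` be a primitive of `h` on each component of `{G > 0}`. Then `(G e^K)' = E' e^K`. Since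
`G` vanishes at the left end of a component, the kernel `h(s) e^{K(x) - K(s)}`, for `x < s` in one
component, carries the density `E'` to `h G = F'`. Since `G` vanishes at the right end, `K` tends to
infinity there and the kernel has mass one. Regrouping the product of the `a_k` shows that `c_δ` is
`1 / d!` times the density of this chain at the sorted vector (`ae_ofReal_density`), so `C_δ` has
the right order statistics (`lintegral_density_mul_orderStat`); symmetry then yields uniform
marginals. This needs only that `δ_(k)` does not charge `{G = 0}` (`ChargesGaps`), which follows
from `J δ < ∞` and also from the existence of an absolutely continuous copula with multidiagonal
`δ`.

Entropy. Let `C` be any copula with multidiagonal `δ`, and assume `ChargesGaps`. Almost surely under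
`C`, `log c_δ` is a constant plus terms `log δ_(k)'` and `-log G`, each depending on one order
statistic, minus increments of `K` between neighbours (`ae_log_density`). The laws of the order
statistics are prescribed, and by Tonelli each increment has mean `∫ h G = 1`
(`lintegral_hazardIncrement`). The `-log G` terms integrate to `J δ`. If `J δ` is finite, `∫ log c_δ
dC` is thus the constant `crossEntropy δ`, and `integral_entropyIntegrand_le` concludes. If some
copula in the class has finite entropy, the pointwise Gibbs inequality bounds the `-log G` terms by
an integrable function, so `J δ` is finite (`J_lt_top_of_integrable`); this is part (a). -/

lemma monotone_orderStat (u : Fin d → ℝ) : Monotone (orderStat u) :=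
  Tuple.monotone_sort u

lemma orderStat_comp_perm (u : Fin d → ℝ) (π : Equiv.Perm (Fin d)) :
    orderStat (u ∘ π) = orderStat u :=
  Tuple.comp_perm_comp_sort_eq_comp_sort

lemma orderStat_of_monotone {u : Fin d → ℝ} (hu : Monotone u) : orderStat u = u := by
  rw [orderStat, Tuple.sort_eq_refl_iff_monotone.2 hu]; rfl

lemma orderStat_of_comp_monotone {u : Fin d → ℝ} {π : Equiv.Perm (Fin d)}
    (hu : Monotone (u ∘ π)) : orderStat u = u ∘ π := by
  rw [← orderStat_comp_perm u π, orderStat_of_monotone hu]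

lemma sum_orderStat {M : Type*} [AddCommMonoid M] (g : ℝ → M) (u : Fin d → ℝ) :
    ∑ i, g (orderStat u i) = ∑ i, g (u i) :=
  Equiv.sum_comp (Tuple.sort u) fun i => g (u i)

/-- `Tuple.sort` breaks ties by index, so fixing its value amounts to finitely many comparisons of
coordinates. -/
lemma measurableSet_sort_eq (π : Equiv.Perm (Fin d)) :
    MeasurableSet {u : Fin d → ℝ | Tuple.sort u = π} := by
  have : {u : Fin d → ℝ | Tuple.sort u = π} =
      {u | (∀ i j, i ≤ j → u (π i) ≤ u (π j)) ∧
        ∀ i j, i < j → u (π i) = u (π j) → π i < π j} := by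
    ext u
    rw [mem_ofPred_eq, eq_comm, Tuple.eq_sort_iff]
    rfl
  rw [this]
  measurability

lemma measurable_orderStat : Measurable (orderStat : (Fin d → ℝ) → Fin d → ℝ) := by
  intro s hs
  have : orderStat ⁻¹' s =
      ⋃ π : Equiv.Perm (Fin d), {u | Tuple.sort u = π} ∩ {u : Fin d → ℝ | u ∘ π ∈ s} := by
    ext u
    simp [orderStat]
  rw [this]
  refine MeasurableSet.iUnion fun π => (measurableSet_sort_eq π).inter ?_
  exact measurable_pi_lambda _ (fun i => measurable_pi_apply (π i)) hs

@[fun_prop]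
lemma measurable_orderStat_apply (i : Fin d) :
    Measurable (fun u : Fin d → ℝ => orderStat u i) :=
  (measurable_pi_apply i).comp measurable_orderStat

lemma measurePreserving_comp_perm (π : Equiv.Perm (Fin d)) :
    MeasurePreserving (fun u : Fin d → ℝ => u ∘ π) := by
  have h := volume_measurePreserving_piCongrLeft (fun _ : Fin d => ℝ) π.symm
  have h2 : (fun u : Fin d → ℝ => u ∘ π) =
      MeasurableEquiv.piCongrLeft (fun _ : Fin d => ℝ) π.symm := by
    funext u i
    obtain ⟨j, rfl⟩ := π.symm.surjective i
    simp [MeasurableEquiv.piCongrLeft, Equiv.piCongrLeft_apply_apply]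
  rw [h2]
  exact h

/-- Each coincidence of two coordinates defines a proper subspace, which is Lebesgue null. -/
lemma ae_injective : ∀ᵐ u : Fin d → ℝ, Function.Injective u := by
  have : ∀ i j : Fin d, i ≠ j → ∀ᵐ u : Fin d → ℝ, u i ≠ u j := by
    intro i j hij
    let S : Submodule ℝ (Fin d → ℝ) :=
      LinearMap.ker ((LinearMap.proj i : (Fin d → ℝ) →ₗ[ℝ] ℝ) - LinearMap.proj j)
    have hS : S ≠ ⊤ := by
      intro h
      have : Pi.single i (1 : ℝ) ∈ S := h ▸ Submodule.mem_top
      simp [S, hij.symm] at this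
    have h0 := Measure.addHaar_submodule (volume : Measure (Fin d → ℝ)) S hS
    rw [ae_iff]
    convert h0 using 2
    ext u
    simp [S, sub_eq_zero]
  have h2 : ∀ᵐ u : Fin d → ℝ, ∀ i j : Fin d, i ≠ j → u i ≠ u j := by
    simp only [ae_all_iff, Filter.eventually_imp_distrib_left]
    exact this
  filter_upwards [h2] with u hu i j hij
  by_contra h
  exact hu i j h hij

lemma strictMono_orderStat {u : Fin d → ℝ} (hu : Function.Injective u) :
    StrictMono (orderStat u) :=
  (monotone_orderStat u).strictMono_of_injective (hu.comp (Tuple.sort u).injective)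

lemma measurableSet_strictMono : MeasurableSet {x : Fin d → ℝ | StrictMono x} := by
  simp only [StrictMono]
  measurability

/-- Sorting maps Lebesgue measure to `d!` times its restriction to the open cone of increasing
vectors. -/
lemma lintegral_orderStat {g : (Fin d → ℝ) → ℝ≥0∞} (hg : Measurable g) :
    ∫⁻ u, g (orderStat u) = d ! * ∫⁻ x in {x : Fin d → ℝ | StrictMono x}, g x := by
  classical
  -- With distinct coordinates exactly one permutation sorts `u`, so a single summand survives.
  have h1 : ∀ᵐ u : Fin d → ℝ, g (orderStat u) =
      ∑ π : Equiv.Perm (Fin d), {x : Fin d → ℝ | StrictMono x}.indicator g (u ∘ π) := by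
    filter_upwards [ae_injective] with u hu
    rw [Finset.sum_eq_single (Tuple.sort u)]
    · rw [indicator_of_mem]
      · rfl
      · exact strictMono_orderStat hu
    · intro π _ hπ
      rw [indicator_of_notMem]
      intro h
      apply hπ
      have := orderStat_of_comp_monotone (u := u) (π := π) h.monotone
      ext1 i
      exact hu (congrFun this i).symm
    · simp
  rw [lintegral_congr_ae h1, lintegral_finsetSum]
  · have h2 : ∀ π : Equiv.Perm (Fin d),
        ∫⁻ u : Fin d → ℝ, {x : Fin d → ℝ | StrictMono x}.indicator g (u ∘ π) =
          ∫⁻ x in {x : Fin d → ℝ | StrictMono x}, g x := by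
      intro π
      rw [← lintegral_indicator measurableSet_strictMono]
      exact (measurePreserving_comp_perm π).lintegral_comp
        (hg.indicator measurableSet_strictMono)
    simp [h2, Fintype.card_perm]
  · intro π _
    exact (hg.indicator measurableSet_strictMono).comp (measurePreserving_comp_perm π).measurable

end OrderStatistics

end MultidiagCopula

/-! ### Composition with absolutely continuous functions. -/

/-- The outer function is Lipschitz on the compact interval of values. Smoothness is asked only
there, so that a logarithm away from its singularity is allowed. -/
lemma AbsolutelyContinuousOnInterval.contDiffOn_comp {f g : ℝ → ℝ} {a b m M : ℝ}
    (hf : AbsolutelyContinuousOnInterval f a b) (hfm : MapsTo f (uIcc a b) (Icc m M))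
    (hg : ContDiffOn ℝ 1 g (Icc m M)) :
    AbsolutelyContinuousOnInterval (fun x => g (f x)) a b := by
  obtain ⟨K, hK⟩ := hg.exists_lipschitzOnWith (by decide) (convex_Icc _ _) isCompact_Icc
  unfold AbsolutelyContinuousOnInterval at hf ⊢
  refine squeeze_zero' (.of_forall fun _ => Finset.sum_nonneg fun i _ => dist_nonneg) ?_
    (by simpa using hf.const_mul (K : ℝ))
  rw [eventually_inf_principal]
  filter_upwards with ⟨n, I⟩ hnI
  rw [Finset.mul_sum]
  gcongr with i hi
  exact hK.dist_le_mul _ (hfm (hnI.1 i hi).1) _ (hfm (hnI.1 i hi).2)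

lemma AbsolutelyContinuousOnInterval.exp {f : ℝ → ℝ} {a b : ℝ}
    (hf : AbsolutelyContinuousOnInterval f a b) :
    AbsolutelyContinuousOnInterval (fun x => Real.exp (f x)) a b := by
  obtain ⟨M, hM⟩ := hf.exists_bound
  exact hf.contDiffOn_comp (m := -M) (M := M) (fun x hx => abs_le.1 (hM x hx))
    Real.contDiff_exp.contDiffOn

namespace MultidiagCopula

/-! ### Components of open subsets of the unit interval. -/

section OpenSets

variable {O : Set ℝ} {x y t : ℝ}

lemma uIcc_mem_iff : y ∈ ordConnectedComponent O t ↔ uIcc t y ⊆ O := Iff.rfl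

lemma isOpen_ordConnectedComponent (hO : IsOpen O) : IsOpen (ordConnectedComponent O t) := by
  rw [isOpen_iff_mem_nhds]
  intro y hy
  rw [ordConnectedComponent_eq hy, ordConnectedComponent_mem_nhds]
  exact hO.mem_nhds (ordConnectedComponent_subset hy)

/-- The components of a bounded open set are bounded open intervals with end points outside. -/
lemma exists_ordConnectedComponent_eq_Ioo (hO : IsOpen O) (hb : O ⊆ Icc 0 1) (ht : t ∈ O) :
    ∃ g e, ordConnectedComponent O t = Ioo g e ∧ g ∉ O ∧ e ∉ O ∧ g < t ∧ t < e := by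
  set I := ordConnectedComponent O t with hI
  have hopen : IsOpen I := isOpen_ordConnectedComponent hO
  have htI : t ∈ I := self_mem_ordConnectedComponent.2 ht
  have hsub : I ⊆ Icc 0 1 := ordConnectedComponent_subset.trans hb
  have hbb : BddBelow I := bddBelow_Icc.mono hsub
  have hba : BddAbove I := bddAbove_Icc.mono hsub
  have hlo : ∀ y ∈ I, sInf I < y := by
    intro y hy
    obtain ⟨l, hl, hly⟩ := (mem_nhds_iff_exists_Ioo_subset.1 (hopen.mem_nhds hy))
    obtain ⟨z, hz1, hz2⟩ := exists_between hly.1.1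
    exact (csInf_le hbb (hly.2 ⟨hz1, hz2.trans hly.1.2⟩)).trans_lt hz2
  have hup : ∀ y ∈ I, y < sSup I := by
    intro y hy
    obtain ⟨l, hl, hly⟩ := (mem_nhds_iff_exists_Ioo_subset.1 (hopen.mem_nhds hy))
    obtain ⟨z, hz1, hz2⟩ := exists_between hly.1.2
    exact hz1.trans_le (le_csSup hba (hly.2 ⟨hly.1.1.trans hz1, hz2⟩))
  have hIoo : I = Ioo (sInf I) (sSup I) := by
    refine subset_antisymm (fun y hy => ⟨hlo y hy, hup y hy⟩) fun y hy => ?_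
    obtain ⟨p, hp, hpy⟩ := exists_lt_of_csInf_lt ⟨t, htI⟩ hy.1
    obtain ⟨r, hr, hry⟩ := exists_lt_of_lt_csSup ⟨t, htI⟩ hy.2
    have : OrdConnected I := inferInstance
    exact this.out hp hr ⟨hpy.le, hry.le⟩
  -- A boundary point lying in `O` would have a neighbourhood inside its own component; that
  -- component would meet `I` and hence equal it.
  have key : ∀ z ∈ closure I, z ∉ I → z ∉ O := by
    intro z hz hzI hzO
    have hn : ordConnectedComponent O z ∈ 𝓝 z :=
      ordConnectedComponent_mem_nhds.2 (hO.mem_nhds hzO)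
    obtain ⟨w, hw1, hw2⟩ := mem_closure_iff_nhds.1 hz _ hn
    apply hzI
    rw [hI, ordConnectedComponent_eq hw2, ← ordConnectedComponent_eq hw1]
    exact self_mem_ordConnectedComponent.2 hzO
  refine ⟨sInf I, sSup I, hIoo, key _ (csInf_mem_closure ⟨t, htI⟩ hbb) ?_,
    key _ (csSup_mem_closure ⟨t, htI⟩ hba) ?_, hlo t htI, hup t htI⟩
  · exact fun h => (hlo _ h).false
  · exact fun h => (hup _ h).false

/-- The midpoint of the component of `t` in `O`. -/
noncomputable def componentMid (O : Set ℝ) (t : ℝ) : ℝ :=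
  (sInf (ordConnectedComponent O t) + sSup (ordConnectedComponent O t)) / 2

lemma componentMid_mem (hO : IsOpen O) (hb : O ⊆ Icc 0 1) (ht : t ∈ O) :
    componentMid O t ∈ ordConnectedComponent O t := by
  obtain ⟨g, e, h, -, -, h1, h2⟩ := exists_ordConnectedComponent_eq_Ioo hO hb ht
  have hge := h1.trans h2
  rw [componentMid, h, csInf_Ioo hge, csSup_Ioo hge]
  constructor <;> linarith

/-- The base point is constant along a component, so differences of `cumHazard` there are plain
integrals of the rate. -/
lemma componentMid_eq (h : uIcc x y ⊆ O) : componentMid O x = componentMid O y := by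
  rw [componentMid, componentMid, ordConnectedComponent_eq h]

end OpenSets

/-! ### One step of the chain: the rate, its primitive and the kernel. -/

/-- A pair of distribution functions `F ≤ E` of Lipschitz distributions on `[0, 1]`. -/
structure GapPair (E F : ℝ → ℝ) : Prop where
  mono_left : Monotone E
  mono_right : Monotone F
  lip_left : ∃ c, LipschitzWith c E
  lip_right : ∃ c, LipschitzWith c F
  le : ∀ t, F t ≤ E t
  eq_of_le : ∀ t ≤ 0, F t = E t
  eq_of_ge : ∀ t, 1 ≤ t → F t = E t

/-- The set where `F < E`. -/
def gapSet (E F : ℝ → ℝ) : Set ℝ := {s | F s < E s}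

/-- The rate at which a chain with successive laws `E`, `F` jumps. -/
noncomputable def hazard (E F : ℝ → ℝ) (s : ℝ) : ℝ := deriv F s / (E s - F s)

/-- The primitive of the rate, from the midpoint of each component of `gapSet E F`. -/
noncomputable def cumHazard (E F : ℝ → ℝ) (t : ℝ) : ℝ :=
  ∫ s in (componentMid (gapSet E F) t)..t, hazard E F s

lemma setLIntegral_Ioc_ofReal {g : ℝ → ℝ} {v : ℝ} {x y : ℝ} (hle : x ≤ y) (hg : ∀ s, 0 ≤ g s)
    (hi : IntervalIntegrable g volume x y) (hv : ∫ s in x..y, g s = v) :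
    ∫⁻ s in Ioc x y, ENNReal.ofReal (g s) = ENNReal.ofReal v := by
  rw [← ofReal_integral_eq_lintegral_ofReal, ← intervalIntegral.integral_of_le hle, hv]
  · exact (intervalIntegrable_iff_integrableOn_Ioc_of_le hle).1 hi
  · exact .of_forall hg

namespace GapPair

variable {E F : ℝ → ℝ} (h : GapPair E F) {x y t : ℝ}
include h

lemma continuous_left : Continuous E := h.lip_left.choose_spec.continuous

lemma continuous_right : Continuous F := h.lip_right.choose_spec.continuous

lemma isOpen_gapSet : IsOpen (gapSet E F) :=
  isOpen_lt h.continuous_right h.continuous_left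

lemma gapSet_subset : gapSet E F ⊆ Icc 0 1 := by
  intro t ht
  constructor <;> by_contra! h'
  · exact (h.eq_of_le t h'.le).not_lt ht
  · exact (h.eq_of_ge t h'.le).not_lt ht

lemma measurable_hazard : Measurable (hazard E F) :=
  (measurable_deriv F).div (h.continuous_left.sub h.continuous_right).measurable

lemma hazard_nonneg (s : ℝ) : 0 ≤ hazard E F s :=
  div_nonneg h.mono_right.deriv_nonneg (sub_nonneg.2 (h.le s))

lemma absolutelyContinuous_left (a b : ℝ) : AbsolutelyContinuousOnInterval E a b :=
  (h.lip_left.choose_spec.lipschitzOnWith (s := uIcc a b)).absolutelyContinuousOnInterval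

lemma absolutelyContinuous_right (a b : ℝ) : AbsolutelyContinuousOnInterval F a b :=
  (h.lip_right.choose_spec.lipschitzOnWith (s := uIcc a b)).absolutelyContinuousOnInterval

lemma intervalIntegrable_hazard (hxy : uIcc x y ⊆ gapSet E F) :
    IntervalIntegrable (hazard E F) volume x y := by
  simp only [funext fun s => show hazard E F s = deriv F s * (E s - F s)⁻¹ from div_eq_mul_inv _ _]
  refine (h.absolutelyContinuous_right x y).intervalIntegrable_deriv.mul_continuousOn ?_
  refine (h.continuous_left.sub h.continuous_right).continuousOn.inv₀ fun s hs => ?_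
  exact (sub_pos.2 (hxy hs)).ne'

lemma cumHazard_sub (hxy : uIcc x y ⊆ gapSet E F) :
    cumHazard E F y - cumHazard E F x = ∫ s in x..y, hazard E F s := by
  have hx : x ∈ gapSet E F := hxy left_mem_uIcc
  have hy : y ∈ gapSet E F := hxy right_mem_uIcc
  rw [cumHazard, cumHazard, ← componentMid_eq hxy]
  apply intervalIntegral.integral_interval_sub_left
  · apply h.intervalIntegrable_hazard
    rw [componentMid_eq hxy, uIcc_comm]
    exact componentMid_mem h.isOpen_gapSet h.gapSet_subset hy
  · apply h.intervalIntegrable_hazard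
    rw [uIcc_comm]
    exact componentMid_mem h.isOpen_gapSet h.gapSet_subset hx

/-- Rational end points leave countably many intervals, so that almost everywhere statements on each
of them combine. -/
lemma exists_rat_Icc_subset (ht : t ∈ gapSet E F) :
    ∃ a b : ℚ, (a : ℝ) < t ∧ t < b ∧ Icc (a : ℝ) b ⊆ gapSet E F := by
  obtain ⟨l, u, hlu, hs⟩ := mem_nhds_iff_exists_Ioo_subset.1 (h.isOpen_gapSet.mem_nhds ht)
  obtain ⟨a, ha1, ha2⟩ := exists_rat_btwn hlu.1
  obtain ⟨b, hb1, hb2⟩ := exists_rat_btwn hlu.2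
  exact ⟨a, b, ha2, hb1, fun z hz => hs ⟨ha1.trans_le hz.1, hz.2.trans_lt hb2⟩⟩

lemma cumHazard_eq {a b : ℝ} (hab : Icc a b ⊆ gapSet E F) (hy : y ∈ Icc a b) :
    cumHazard E F y = cumHazard E F a + ∫ s in a..y, hazard E F s := by
  rw [← h.cumHazard_sub, add_sub_cancel]
  rw [uIcc_of_le hy.1]
  exact (Icc_subset_Icc_right hy.2).trans hab

/-- The base point of `cumHazard` varies with the component. On each rational interval inside the
gap set it is fixed, and Lebesgue differentiation applies. -/
lemma ae_hasDerivAt_cumHazard :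
    ∀ᵐ t, t ∈ gapSet E F → HasDerivAt (cumHazard E F) (hazard E F t) t := by
  have h1 : ∀ᵐ t, ∀ a b : ℚ, a < b → Icc (a : ℝ) b ⊆ gapSet E F → t ∈ Icc (a : ℝ) b →
      HasDerivAt (fun x => ∫ s in (a : ℝ)..x, hazard E F s) (hazard E F t) t := by
    rw [ae_all_iff]; intro a
    rw [ae_all_iff]; intro b
    by_cases hab : a < b
    swap
    · exact .of_forall fun t hab' => absurd hab' hab
    have hab' : (a : ℝ) ≤ b := by exact_mod_cast hab.le
    by_cases hs : Icc (a : ℝ) b ⊆ gapSet E F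
    swap
    · exact .of_forall fun t _ hs' => absurd hs' hs
    rw [← uIcc_of_le hab'] at hs ⊢
    filter_upwards [(h.intervalIntegrable_hazard hs).ae_hasDerivAt_integral] with t ht _ _ htm
    exact ht htm _ left_mem_uIcc
  filter_upwards [h1] with t ht htO
  obtain ⟨a, b, hat, htb, hs⟩ := h.exists_rat_Icc_subset htO
  have hd := ht a b (by exact_mod_cast hat.trans htb) hs ⟨hat.le, htb.le⟩
  refine (hd.const_add (cumHazard E F a)).congr_of_eventuallyEq ?_
  filter_upwards [Ioo_mem_nhds hat htb] with y hy
  exact h.cumHazard_eq hs (Ioo_subset_Icc_self hy)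

lemma absolutelyContinuous_integral_hazard (hxy : uIcc x y ⊆ gapSet E F) :
    AbsolutelyContinuousOnInterval (fun z => ∫ s in x..z, hazard E F s) x y :=
  (h.intervalIntegrable_hazard hxy).absolutelyContinuousOnInterval_intervalIntegral left_mem_uIcc

lemma continuousOn_cumHazard : ContinuousOn (cumHazard E F) (gapSet E F) := by
  intro t ht
  obtain ⟨a, b, hat, htb, hs⟩ := h.exists_rat_Icc_subset ht
  apply ContinuousAt.continuousWithinAt
  have hc : ContinuousOn (cumHazard E F) (Icc (a : ℝ) b) := by
    have hab := (hat.trans htb).le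
    have := (h.absolutelyContinuous_integral_hazard (by rwa [uIcc_of_le hab])).continuousOn
    rw [uIcc_of_le hab] at this
    exact (continuousOn_const.add this).congr fun y hy => h.cumHazard_eq hs hy
  exact hc.continuousAt (Icc_mem_nhds hat htb)

lemma cumHazard_le (hxy : Icc x y ⊆ gapSet E F) (hle : x ≤ y) :
    cumHazard E F x ≤ cumHazard E F y := by
  rw [← sub_nonneg, h.cumHazard_sub (by rwa [uIcc_of_le hle])]
  exact intervalIntegral.integral_nonneg hle fun s _ => h.hazard_nonneg s

/-- Local monotonicity gives the sign at every point, not only where the derivative is the rate;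
`density` has to be non-negative everywhere. -/
lemma deriv_cumHazard_nonneg (ht : t ∈ gapSet E F) : 0 ≤ deriv (cumHazard E F) t := by
  obtain ⟨a, b, hat, htb, hs⟩ := h.exists_rat_Icc_subset ht
  have hm : MonotoneOn (cumHazard E F) (Ioo (a : ℝ) b) := fun x hx y hy hxy =>
    h.cumHazard_le ((Icc_subset_Icc hx.1.le hy.2.le).trans hs) hxy
  rw [← derivWithin_of_mem_nhds (Ioo_mem_nhds hat htb)]
  exact hm.derivWithin_nonneg

/-- The integrated form of `(G e^K)' = E' e^K`, where `G = E - F` and `K` is the primitive of the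
rate. -/
lemma integral_deriv_left_mul_exp (hxy : Icc x y ⊆ gapSet E F) (hle : x ≤ y) :
    ∫ s in x..y, deriv E s * Real.exp (cumHazard E F s - cumHazard E F y) =
      (E y - F y) - (E x - F x) * Real.exp (cumHazard E F x - cumHazard E F y) := by
  have hxy' : uIcc x y ⊆ gapSet E F := by rwa [uIcc_of_le hle]
  set k : ℝ → ℝ := fun z => ∫ s in x..z, hazard E F s with hk
  have hac := h.absolutelyContinuous_integral_hazard hxy'
  have hG : AbsolutelyContinuousOnInterval (fun z => E z - F z) x y :=
    (h.absolutelyContinuous_left x y).sub (h.absolutelyContinuous_right x y)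
  have hp := hG.integral_deriv_mul_eq_sub hac.exp
  have hKk : ∀ z ∈ uIcc x y, cumHazard E F z = cumHazard E F x + k z := fun z hz =>
    h.cumHazard_eq hxy (by rwa [uIcc_of_le hle] at hz)
  -- In the product rule `(E' - F') e^k + (E - F) h e^k`, the last term equals `F' e^k` and cancels
  -- the negative one.
  have e1 : ∫ s in x..y, deriv E s * Real.exp (cumHazard E F s - cumHazard E F y) =
      ∫ s in x..y, Real.exp (-k y) * (deriv (fun z => E z - F z) s * Real.exp (k s) +
        (E s - F s) * deriv (fun z => Real.exp (k z)) s) := by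
    apply intervalIntegral.integral_congr_ae
    filter_upwards [(h.absolutelyContinuous_left x y).ae_differentiableAt,
      (h.absolutelyContinuous_right x y).ae_differentiableAt,
      (h.intervalIntegrable_hazard hxy').ae_hasDerivAt_integral] with s h1 h2 h3 hs
    have hs' := uIoc_subset_uIcc hs
    have d3 : deriv (fun z => Real.exp (k z)) s = Real.exp (k s) * hazard E F s :=
      (h3 hs' x left_mem_uIcc).exp.deriv
    have d1 := ((h1 hs').hasDerivAt.sub (h2 hs').hasDerivAt).deriv
    have d1' : deriv (fun z => E z - F z) s = deriv E s - deriv F s := d1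
    have hpos : 0 < E s - F s := sub_pos.2 (hxy' hs')
    rw [d1', d3, hKk s hs', hKk y right_mem_uIcc,
      show cumHazard E F x + k s - (cumHazard E F x + k y) = -k y + k s by ring, Real.exp_add]
    rw [hazard]
    field_simp
    ring
  rw [e1, intervalIntegral.integral_const_mul, hp, hKk y right_mem_uIcc]
  simp only [intervalIntegral.integral_same, Real.exp_zero, mul_one]
  rw [show cumHazard E F x - (cumHazard E F x + k y) = -k y by ring, mul_sub,
    show (∫ s in x..y, hazard E F s) = k y from rfl, Real.exp_neg]
  field_simp

/-- The integrand is almost everywhere the derivative of `-e^{K(x) - K(s)}` in `s`. -/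
lemma integral_hazard_mul_exp (hxy : Icc x y ⊆ gapSet E F) (hle : x ≤ y) :
    ∫ s in x..y, hazard E F s * Real.exp (cumHazard E F x - cumHazard E F s) =
      1 - Real.exp (cumHazard E F x - cumHazard E F y) := by
  have hxy' : uIcc x y ⊆ gapSet E F := by rwa [uIcc_of_le hle]
  set k : ℝ → ℝ := fun z => ∫ s in x..z, hazard E F s with hk
  have hac := (h.absolutelyContinuous_integral_hazard hxy').neg.exp
  have hp := hac.integral_deriv_eq_sub
  have hKk : ∀ z ∈ uIcc x y, cumHazard E F x - cumHazard E F z = - k z := fun z hz => by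
    rw [h.cumHazard_eq hxy (y := z) (by rwa [uIcc_of_le hle] at hz)]
    ring
  have e1 : ∫ s in x..y, hazard E F s * Real.exp (cumHazard E F x - cumHazard E F s) =
      ∫ s in x..y, -deriv (fun z => Real.exp ((-k) z)) s := by
    apply intervalIntegral.integral_congr_ae
    filter_upwards [(h.intervalIntegrable_hazard hxy').ae_hasDerivAt_integral] with s h3 hs
    have hs' := uIoc_subset_uIcc hs
    have d3 : deriv (fun z => Real.exp ((-k) z)) s = Real.exp (-k s) * -hazard E F s :=
      (h3 hs' x left_mem_uIcc).neg.exp.deriv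
    rw [hKk s hs', d3]
    ring
  rw [e1, intervalIntegral.integral_neg, hp, hKk y right_mem_uIcc]
  simp [hk]

/-- The support of the transition density: pairs `x < s` in the same component. -/
lemma setOf_Ioo_subset_left {s : ℝ} (hs : s ∈ gapSet E F) :
    ∃ g, g < s ∧ g ∉ gapSet E F ∧
      {x | x < s ∧ x ∈ gapSet E F ∧ Ioo x s ⊆ gapSet E F} = Ioo g s := by
  obtain ⟨g, e, hI, hg, he, hgs, hse⟩ :=
    exists_ordConnectedComponent_eq_Ioo h.isOpen_gapSet h.gapSet_subset hs
  refine ⟨g, hgs, hg, ?_⟩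
  ext x
  constructor
  · rintro ⟨hxs, hx, hsub⟩
    have : x ∈ ordConnectedComponent (gapSet E F) s := by
      rw [uIcc_mem_iff, uIcc_of_ge hxs.le]
      intro z hz
      rcases hz.1.eq_or_lt with rfl | h1
      · exact hx
      rcases hz.2.eq_or_lt with rfl | h2
      · exact hs
      exact hsub ⟨h1, h2⟩
    exact ⟨(hI ▸ this).1, hxs⟩
  · intro hx
    have : x ∈ ordConnectedComponent (gapSet E F) s := hI ▸ ⟨hx.1, hx.2.trans hse⟩
    have h2 := uIcc_mem_iff.1 this
    rw [uIcc_of_ge hx.2.le] at h2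
    exact ⟨hx.2, h2 ⟨le_rfl, hx.2.le⟩, Ioo_subset_Icc_self.trans h2⟩

lemma setOf_Ioo_subset_right (hx : x ∈ gapSet E F) :
    ∃ e, x < e ∧ e ∉ gapSet E F ∧
      {s | x < s ∧ s ∈ gapSet E F ∧ Ioo x s ⊆ gapSet E F} = Ioo x e := by
  obtain ⟨g, e, hI, hg, he, hgs, hse⟩ :=
    exists_ordConnectedComponent_eq_Ioo h.isOpen_gapSet h.gapSet_subset hx
  refine ⟨e, hse, he, ?_⟩
  ext s
  constructor
  · rintro ⟨hxs, hs, hsub⟩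
    have : s ∈ ordConnectedComponent (gapSet E F) x := by
      rw [uIcc_mem_iff, uIcc_of_le hxs.le]
      intro z hz
      rcases hz.1.eq_or_lt with rfl | h1
      · exact hx
      rcases hz.2.eq_or_lt with rfl | h2
      · exact hs
      exact hsub ⟨h1, h2⟩
    exact ⟨hxs, (hI ▸ this).2⟩
  · intro hs
    have : s ∈ ordConnectedComponent (gapSet E F) x := hI ▸ ⟨hgs.trans hs.1, hs.2⟩
    have h2 := uIcc_mem_iff.1 this
    rw [uIcc_of_le hs.1.le] at h2
    exact ⟨hs.1, h2 ⟨hs.1.le, le_rfl⟩, Ioo_subset_Icc_self.trans h2⟩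

lemma eq_of_notMem (ht : t ∉ gapSet E F) : E t = F t :=
  le_antisymm (not_lt.1 ht) (h.le t)

lemma aemeasurable_cumHazard {O : Set ℝ} (hO : MeasurableSet O) (hs : O ⊆ gapSet E F) :
    AEMeasurable (cumHazard E F) (volume.restrict O) :=
  (h.continuousOn_cumHazard.mono hs).aemeasurable hO

lemma continuousOn_exp_cumHazard {a b : ℝ} (hs : Icc x y ⊆ gapSet E F) (hle : x ≤ y) :
    ContinuousOn (fun s => Real.exp (a * cumHazard E F s - b)) (uIcc x y) := by
  rw [uIcc_of_le hle]
  exact ((continuousOn_const.mul (h.continuousOn_cumHazard.mono hs)).sub continuousOn_const).rexp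

/-- The transition density maps the law of distribution function `E` to that of `F`. -/
lemma lintegral_deriv_left_mul_exp {s : ℝ} (hs : s ∈ gapSet E F) :
    ∫⁻ x in {x | x < s ∧ x ∈ gapSet E F ∧ Ioo x s ⊆ gapSet E F},
      ENNReal.ofReal (deriv E x * Real.exp (cumHazard E F x - cumHazard E F s)) =
      ENNReal.ofReal (E s - F s) := by
  obtain ⟨g, hgs, hg, hset⟩ := h.setOf_Ioo_subset_left hs
  have hsub : ∀ x ∈ Ioo g s, Icc x s ⊆ gapSet E F := by
    intro x hx z hz
    rcases hz.2.eq_or_lt with rfl | h2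
    · exact hs
    · have : z ∈ Ioo g s := ⟨hx.1.trans_le hz.1, h2⟩
      rw [← hset] at this
      exact this.2.1
  rw [hset]
  have hcov : AECover (volume.restrict (Ioo g s)) (𝓝[>] g) fun x => Ioc x s :=
    aecover_Ioo_of_Ioc (tendsto_id.mono_left nhdsWithin_le_nhds) tendsto_const_nhds
  refine hcov.lintegral_eq_of_tendsto _ ?_ ?_
  · refine ((measurable_deriv E).aemeasurable.mul
      ((h.aemeasurable_cumHazard measurableSet_Ioo ?_).sub_const _).exp).ennreal_ofReal
    exact fun x hx => hsub x hx ⟨le_rfl, hx.2.le⟩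
  · have hev : ∀ᶠ x in 𝓝[>] g, x ∈ Ioo g s := Ioo_mem_nhdsGT hgs
    have hGg : E g - F g = 0 := sub_eq_zero.2 (h.eq_of_notMem hg)
    -- The boundary term is at most `E x - F x`, because `K` increases, and the gap closes at the
    -- left end `g`.
    have hlim : Tendsto (fun x => (E x - F x) * Real.exp (cumHazard E F x - cumHazard E F s))
        (𝓝[>] g) (𝓝 0) := by
      have h0 : Tendsto (fun x => E x - F x) (𝓝[>] g) (𝓝 0) := by
        rw [← hGg]
        exact ((h.continuous_left.sub h.continuous_right).tendsto g).mono_left nhdsWithin_le_nhds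
      refine squeeze_zero' (.of_forall fun x =>
        mul_nonneg (sub_nonneg.2 (h.le x)) (Real.exp_nonneg _)) ?_ h0
      filter_upwards [hev] with x hx
      refine mul_le_of_le_one_right (sub_nonneg.2 (h.le x)) (Real.exp_le_one_iff.2 ?_)
      exact sub_nonpos.2 (h.cumHazard_le (hsub x hx) hx.2.le)
    have hlim2 := ENNReal.tendsto_ofReal ((tendsto_const_nhds (x := E s - F s)).sub hlim)
    rw [sub_zero] at hlim2
    refine hlim2.congr' ?_
    filter_upwards [hev] with x hx
    rw [Measure.restrict_restrict measurableSet_Ioc]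
    have : (Ioc x s ∩ Ioo g s : Set ℝ) =ᵐ[volume] Ioc x s := by
      have h1 : Ioc x s ∩ Ioo g s = Ioo x s := by
        ext z
        simp only [mem_inter_iff, mem_Ioc, mem_Ioo]
        have := hx.1
        constructor
        · rintro ⟨h1, h2⟩; exact ⟨h1.1, h2.2⟩
        · rintro ⟨h1, h2⟩; exact ⟨⟨h1, h2.le⟩, this.trans h1, h2⟩
      rw [h1]
      exact Ioo_ae_eq_Ioc
    rw [setLIntegral_congr this]
    symm
    refine setLIntegral_Ioc_ofReal hx.2.le
      (fun z => mul_nonneg h.mono_left.deriv_nonneg (Real.exp_nonneg _)) ?_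
      (h.integral_deriv_left_mul_exp (hsub x hx) hx.2.le)
    refine (h.absolutelyContinuous_left x s).intervalIntegrable_deriv.mul_continuousOn ?_
    simpa using h.continuousOn_exp_cumHazard (a := 1) (hsub x hx) hx.2.le

/-- The transition density is a probability density. -/
lemma lintegral_hazard_mul_exp (hx : x ∈ gapSet E F) :
    ∫⁻ s in {s | x < s ∧ s ∈ gapSet E F ∧ Ioo x s ⊆ gapSet E F},
      ENNReal.ofReal (hazard E F s * Real.exp (cumHazard E F x - cumHazard E F s)) = 1 := by
  obtain ⟨e, hxe, he, hset⟩ := h.setOf_Ioo_subset_right hx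
  have hsub : ∀ y ∈ Ioo x e, Icc x y ⊆ gapSet E F := by
    intro y hy z hz
    rcases hz.1.eq_or_lt with rfl | h2
    · exact hx
    · have : z ∈ Ioo x e := ⟨h2, hz.2.trans_lt hy.2⟩
      rw [← hset] at this
      exact this.2.1
  rw [hset]
  have hcov : AECover (volume.restrict (Ioo x e)) (𝓝[<] e) fun y => Ioc x y :=
    aecover_Ioo_of_Ioc tendsto_const_nhds (tendsto_id.mono_left nhdsWithin_le_nhds)
  refine hcov.lintegral_eq_of_tendsto _ ?_ ?_
  · refine (h.measurable_hazard.aemeasurable.mul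
      ((h.aemeasurable_cumHazard measurableSet_Ioo ?_).const_sub _).exp).ennreal_ofReal
    exact fun y hy => hsub y hy ⟨hy.1.le, le_rfl⟩
  · have hev : ∀ᶠ y in 𝓝[<] e, y ∈ Ioo x e := Ioo_mem_nhdsLT hxe
    have hGe : E e - F e = 0 := sub_eq_zero.2 (h.eq_of_notMem he)
    have hGx : 0 < E x - F x := sub_pos.2 hx
    -- This is the divergence of `K` at the right end: non-negativity of `∫ E' e^K` gives `G(x)
    -- e^{K(x) - K(y)} ≤ G(y)`, and `G(y)` tends to zero.
    have hlim : Tendsto (fun y => Real.exp (cumHazard E F x - cumHazard E F y))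
        (𝓝[<] e) (𝓝 0) := by
      have h0 : Tendsto (fun y => (E y - F y) / (E x - F x)) (𝓝[<] e) (𝓝 0) := by
        have := (((h.continuous_left.sub h.continuous_right).tendsto e).mono_left
          (nhdsWithin_le_nhds (s := Iio e))).div_const (E x - F x)
        simpa [hGe] using this
      refine squeeze_zero' (.of_forall fun x => Real.exp_nonneg _) ?_ h0
      filter_upwards [hev] with y hy
      rw [le_div_iff₀ hGx, mul_comm, ← sub_nonneg,
        ← h.integral_deriv_left_mul_exp (hsub y hy) hy.1.le]
      exact intervalIntegral.integral_nonneg hy.1.le fun z _ =>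
        mul_nonneg h.mono_left.deriv_nonneg (Real.exp_nonneg _)
    have hlim2 := ENNReal.tendsto_ofReal ((tendsto_const_nhds (x := (1 : ℝ))).sub hlim)
    rw [sub_zero, ENNReal.ofReal_one] at hlim2
    refine hlim2.congr' ?_
    filter_upwards [hev] with y hy
    rw [Measure.restrict_restrict measurableSet_Ioc, inter_eq_left.2]
    · symm
      refine setLIntegral_Ioc_ofReal hy.1.le
        (fun z => mul_nonneg (h.hazard_nonneg z) (Real.exp_nonneg _)) ?_
        (h.integral_hazard_mul_exp (hsub y hy) hy.1.le)
      refine (h.intervalIntegrable_hazard ?_).mul_continuousOn ?_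
      · rw [uIcc_of_le hy.1.le]; exact hsub y hy
      · rw [uIcc_of_le hy.1.le]
        exact (continuousOn_const.sub (h.continuousOn_cumHazard.mono (hsub y hy))).rexp
    · exact fun z hz => ⟨hz.1, hz.2.trans_lt hy.2⟩

end GapPair

/-! ### Regularity of multidiagonals. -/

section Multidiagonal

variable {d : ℕ} {δ : Fin d → StieltjesFunction ℝ} {C : Measure (Fin d → ℝ)}

lemma isProbabilityMeasure_map_orderStat (hC : C ∈ copulasWith δ) (i : Fin d) :
    IsProbabilityMeasure (C.map fun u => orderStat u i) :=
  have := hC.1.isProbabilityMeasure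
  Measure.isProbabilityMeasure_map (by fun_prop)

lemma measure_eq_map (hC : C ∈ copulasWith δ) (i : Fin d) :
    (δ i).measure = C.map fun u => orderStat u i := by
  have := isProbabilityMeasure_map_orderStat hC i
  have : δ i = ProbabilityTheory.cdf (C.map fun u => orderStat u i) := by
    ext t
    rw [ProbabilityTheory.cdf_eq_real, map_measureReal_apply (by fun_prop) measurableSet_Iic, hC.2 i t]
    rfl
  rw [this, ProbabilityTheory.measure_cdf]

lemma isProbabilityMeasure_measure (hC : C ∈ copulasWith δ) (i : Fin d) :
    IsProbabilityMeasure (δ i).measure :=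
  measure_eq_map hC i ▸ isProbabilityMeasure_map_orderStat hC i

lemma eq_measureReal_Iic (hC : C ∈ copulasWith δ) (i : Fin d) (t : ℝ) :
    δ i t = (δ i).measure.real (Iic t) := by
  rw [measure_eq_map hC i, map_measureReal_apply (by fun_prop) measurableSet_Iic, hC.2 i t]
  rfl

/-- Sorting does not change the multiset of coordinates, so the laws of the order statistics have
the same sum as the uniform marginals. Absolute continuity and the Lipschitz bound come from here.
-/
lemma sum_measure (hC : C ∈ copulasWith δ) :
    ∑ i, (δ i).measure = (d : ℝ≥0∞) • volume.restrict (Icc (0 : ℝ) 1) := by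
  ext s hs
  have h1 : ∀ i, (δ i).measure s = ∫⁻ u, s.indicator 1 (orderStat u i) ∂C := by
    intro i
    rw [measure_eq_map hC i, ← lintegral_indicator_one hs, lintegral_map]
    · exact measurable_one.indicator hs
    · fun_prop
  have h2 : ∀ i : Fin d, volume.restrict (Icc (0 : ℝ) 1) s = ∫⁻ u, s.indicator 1 (u i) ∂C := by
    intro i
    rw [← hC.1.map_eval i, ← lintegral_indicator_one hs, lintegral_map]
    · exact measurable_one.indicator hs
    · fun_prop
  have hm : Measurable (s.indicator (1 : ℝ → ℝ≥0∞)) := measurable_one.indicator hs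
  rw [Measure.finsetSum_apply, Measure.smul_apply]
  simp_rw [h1]
  calc ∑ i, ∫⁻ u, s.indicator 1 (orderStat u i) ∂C
      = ∫⁻ u, ∑ i, s.indicator 1 (orderStat u i) ∂C :=
        (lintegral_finsetSum _ fun i _ => hm.comp (measurable_orderStat_apply i)).symm
    _ = ∫⁻ u, ∑ i, s.indicator 1 (u i) ∂C := by simp_rw [sum_orderStat]
    _ = ∑ i, ∫⁻ u, s.indicator 1 (u i) ∂C :=
        lintegral_finsetSum _ fun i _ => hm.comp (measurable_pi_apply i)
    _ = _ := by
        simp_rw [← h2]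
        simp

lemma measure_le (hC : C ∈ copulasWith δ) (i : Fin d) :
    (δ i).measure ≤ (d : ℝ≥0∞) • volume.restrict (Icc (0 : ℝ) 1) := by
  classical
  rw [← sum_measure hC]
  intro s
  rw [Measure.finsetSum_apply]
  exact Finset.single_le_sum (f := fun i => (δ i).measure s) (fun _ _ => zero_le) (Finset.mem_univ i)

lemma measure_le_volume (hC : C ∈ copulasWith δ) (i : Fin d) :
    (δ i).measure ≤ (d : ℝ≥0∞) • volume := by
  refine (measure_le hC i).trans fun s => ?_
  simp only [Measure.smul_apply]
  gcongr
  exact Measure.restrict_le_self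

lemma measure_absolutelyContinuous (hC : C ∈ copulasWith δ) (i : Fin d) :
    (δ i).measure ≪ volume :=
  (Measure.absolutelyContinuous_of_le (measure_le_volume hC i)).trans
    Measure.smul_absolutelyContinuous

lemma measure_compl_Icc (hC : C ∈ copulasWith δ) (i : Fin d) : (δ i).measure (Icc 0 1)ᶜ = 0 := by
  refine le_antisymm ((measure_le hC i _).trans ?_) zero_le
  simp [Measure.restrict_apply measurableSet_Icc.compl]

lemma nullSingletonClass_measure (hC : C ∈ copulasWith δ) (i : Fin d) : NullSingletonClass (δ i).measure :=
  ⟨fun x => measure_absolutelyContinuous hC i (by simp)⟩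

lemma mem_Icc_apply (hC : C ∈ copulasWith δ) (i : Fin d) (t : ℝ) : δ i t ∈ Icc (0 : ℝ) 1 := by
  have := isProbabilityMeasure_measure hC i
  rw [eq_measureReal_Iic hC]
  exact ⟨measureReal_nonneg, measureReal_le_one⟩

lemma apply_of_nonpos (hC : C ∈ copulasWith δ) (i : Fin d) {t : ℝ} (ht : t ≤ 0) : δ i t = 0 := by
  rw [eq_measureReal_Iic hC, measureReal_def]
  have := nullSingletonClass_measure hC i
  rw [← measure_congr Iio_ae_eq_Iic, measure_mono_null _ (measure_compl_Icc hC i)]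
  · rfl
  · exact fun x hx hx' => (hx'.1.trans_lt (hx.trans_le ht)).false

lemma apply_of_one_le (hC : C ∈ copulasWith δ) (i : Fin d) {t : ℝ} (ht : 1 ≤ t) : δ i t = 1 := by
  have := isProbabilityMeasure_measure hC i
  rw [eq_measureReal_Iic hC, measureReal_def, (prob_compl_eq_zero_iff measurableSet_Iic).1,
    ENNReal.toReal_one]
  have hsub : (Iic t)ᶜ ⊆ (Icc (0 : ℝ) 1)ᶜ := fun x hx hx' => hx (hx'.2.trans ht)
  exact measure_mono_null hsub (measure_compl_Icc hC i)

lemma apply_antitone (hC : C ∈ copulasWith δ) {i j : Fin d} (hij : i ≤ j) (t : ℝ) :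
    δ j t ≤ δ i t := by
  have := hC.1.isProbabilityMeasure
  rw [hC.2, hC.2]
  exact measureReal_mono fun u hu => (monotone_orderStat u hij).trans hu

lemma lipschitzWith_apply (hC : C ∈ copulasWith δ) (i : Fin d) : LipschitzWith d (δ i) := by
  refine LipschitzWith.of_le_add_mul _ fun x y => ?_
  rcases le_total x y with hxy | hxy
  · exact ((δ i).mono hxy).trans (le_add_of_nonneg_right (by positivity))
  have h1 := (δ i).measure_Ioc y x
  have h2 := measure_le_volume hC i (Ioc y x)
  rw [h1, Measure.smul_apply, Real.volume_Ioc, smul_eq_mul, ← ENNReal.ofReal_natCast,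
    ← ENNReal.ofReal_mul (by positivity), ENNReal.ofReal_le_ofReal_iff
      (mul_nonneg (by positivity) (sub_nonneg.2 hxy))] at h2
  rw [Real.dist_eq, abs_of_nonneg (sub_nonneg.2 hxy)]
  push_cast
  linarith

lemma deriv_nonneg_apply (i : Fin d) (t : ℝ) : 0 ≤ deriv (δ i) t := (δ i).mono.deriv_nonneg

lemma deriv_le (hC : C ∈ copulasWith δ) (i : Fin d) (t : ℝ) : deriv (δ i) t ≤ d := by
  have := norm_deriv_le_of_lipschitz (lipschitzWith_apply hC i) (x₀ := t)
  rw [Real.norm_of_nonneg (deriv_nonneg_apply i t)] at this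
  exact_mod_cast this

lemma measure_eq_withDensity (hC : C ∈ copulasWith δ) (i : Fin d) :
    (δ i).measure = volume.withDensity fun t => ENNReal.ofReal (deriv (δ i) t) := by
  have := isProbabilityMeasure_measure hC i
  refine (Measure.withDensity_rnDeriv_eq _ _ (measure_absolutelyContinuous hC i)).symm.trans ?_
  apply withDensity_congr_ae
  filter_upwards [(δ i).ae_hasDerivAt, Measure.rnDeriv_lt_top (δ i).measure volume] with t ht ht'
  rw [ht.deriv, ENNReal.ofReal_toReal ht'.ne]

lemma lintegral_measure (hC : C ∈ copulasWith δ) (i : Fin d) {g : ℝ → ℝ≥0∞} (hg : Measurable g) :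
    ∫⁻ t, g t ∂(δ i).measure = ∫⁻ t, ENNReal.ofReal (deriv (δ i) t) * g t := by
  rw [measure_eq_withDensity hC i, lintegral_withDensity_eq_lintegral_mul _ _ hg]
  · rfl
  · exact (measurable_deriv _).ennreal_ofReal

lemma ae_deriv_pos (hC : C ∈ copulasWith δ) (i : Fin d) :
    ∀ᵐ t ∂(δ i).measure, 0 < deriv (δ i) t := by
  rw [measure_eq_withDensity hC i, ae_withDensity_iff (measurable_deriv _).ennreal_ofReal]
  filter_upwards with t ht
  simpa using ht

lemma ae_of_ae_measure (hC : C ∈ copulasWith δ) (i : Fin d) {p : ℝ → Prop}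
    (hp : ∀ᵐ t ∂(δ i).measure, p t) : ∀ᵐ u ∂C, p (orderStat u i) := by
  rw [measure_eq_map hC i] at hp
  exact ae_of_ae_map (by fun_prop) hp

lemma deriv_eq_zero_of_ae (hC : C ∈ copulasWith δ) (i : Fin d) {s : Set ℝ}
    (h0 : (δ i).measure sᶜ = 0) : ∀ᵐ t, t ∉ s → deriv (δ i) t = 0 := by
  have : ∀ᵐ t ∂(δ i).measure, t ∈ s := h0
  rw [measure_eq_withDensity hC i, ae_withDensity_iff (measurable_deriv _).ennreal_ofReal] at this
  filter_upwards [this] with t ht hts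
  by_contra hne
  refine hts (ht ?_)
  simpa using lt_of_le_of_ne (deriv_nonneg_apply i t) (Ne.symm hne)

end Multidiagonal

/-! ### From one-based indices to gap pairs. -/

section Ext

variable {d : ℕ} {δ : Fin d → StieltjesFunction ℝ} {C : Measure (Fin d → ℝ)}

lemma ext_succ (i : Fin d) : ext δ (i.val + 1) = δ i := by
  ext t; simp [ext]

lemma gapPair (hC : C ∈ copulasWith δ) {i j : Fin d} (hij : i ≤ j) : GapPair (δ i) (δ j) where
  mono_left := (δ i).mono
  mono_right := (δ j).mono
  lip_left := ⟨_, lipschitzWith_apply hC i⟩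
  lip_right := ⟨_, lipschitzWith_apply hC j⟩
  le := apply_antitone hC hij
  eq_of_le t ht := by rw [apply_of_nonpos hC _ ht, apply_of_nonpos hC _ ht]
  eq_of_ge t ht := by rw [apply_of_one_le hC _ ht, apply_of_one_le hC _ ht]

lemma Psi_succ {i j : Fin d} (hij : i.val + 1 = j.val) :
    Psi δ (j.val + 1) = gapSet (δ i) (δ j) := by
  have h1 : ¬ j.val + 1 = 1 := by lia
  have h2 : ¬ j.val + 1 = d + 1 := by lia
  rw [Psi, if_neg h1, if_neg h2, ext_succ, Nat.add_sub_cancel, ← hij, ext_succ]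
  rfl

lemma K_succ {i j : Fin d} (hij : i.val + 1 = j.val) :
    K δ (j.val + 1) = cumHazard (δ i) (δ j) := by
  have h1 : ¬ j.val + 1 = 1 := by lia
  have h2 : ¬ j.val + 1 = d + 1 := by lia
  ext t
  rw [K, if_neg h2, mid, if_neg h1, Psi_succ hij, ext_succ, Nat.add_sub_cancel, ← hij, ext_succ]
  rfl

lemma K_last : K δ (d + 1) = 0 := by
  ext t; simp [K]

end Ext

/-! ### Markov chains given by densities. -/

section Chain

lemma lintegral_eq_lintegral_snoc {n : ℕ} {g : (Fin (n + 1) → ℝ) → ℝ≥0∞} (hg : Measurable g) :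
    ∫⁻ x, g x = ∫⁻ y : Fin n → ℝ, ∫⁻ s : ℝ, g (Fin.snoc y s) := by
  have hp := (volume_preserving_piFinSuccAbove (fun _ : Fin (n + 1) => ℝ) (Fin.last n)).symm
  rw [← hp.lintegral_comp hg, Measure.volume_eq_prod, lintegral_prod_symm]
  · simp [MeasurableEquiv.piFinSuccAbove, Fin.snocEquiv]
  · exact (hg.comp hp.measurable).aemeasurable

/-- The density of a Markov chain with initial density `f` and transition densities `T k`. -/
noncomputable def chainDensity (f : ℝ → ℝ≥0∞) (T : ℕ → ℝ → ℝ → ℝ≥0∞) (n : ℕ)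
    (x : Fin (n + 1) → ℝ) : ℝ≥0∞ :=
  f (x 0) * ∏ i : Fin n, T i (x i.castSucc) (x i.succ)

lemma chainDensity_snoc (f : ℝ → ℝ≥0∞) (T : ℕ → ℝ → ℝ → ℝ≥0∞) (n : ℕ)
    (y : Fin (n + 1) → ℝ) (s : ℝ) :
    chainDensity f T (n + 1) (Fin.snoc y s) = chainDensity f T n y * T n (y (Fin.last n)) s := by
  rw [chainDensity, chainDensity, Fin.prod_univ_castSucc, mul_assoc]
  refine congrArg₂ (· * ·) ?_ ?_
  · apply congrArg f
    exact Fin.snoc_castSucc (α := fun _ => ℝ) s y 0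
  · simp only [Fin.succ_castSucc, Fin.snoc_castSucc, Fin.val_castSucc, Fin.val_last, Fin.succ_last,
      Fin.snoc_last]

lemma measurable_chainDensity {f : ℝ → ℝ≥0∞} {T : ℕ → ℝ → ℝ → ℝ≥0∞} (hf : Measurable f) {n : ℕ}
    (hT : ∀ k < n, Measurable (Function.uncurry (T k))) : Measurable (chainDensity f T n) := by
  refine (hf.comp (measurable_pi_apply 0)).mul (Finset.measurable_prod _ fun i _ => ?_)
  have : Measurable fun x : Fin (n + 1) → ℝ => (x i.castSucc, x i.succ) := by fun_prop
  exact (hT i i.isLt).comp this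

/-- Induction on the length, splitting off the last coordinate. Its own law comes from `hmap` after
exchanging integrals; for an earlier coordinate it is integrated out by `hone`, which is required
only where the current marginal density is non-zero. -/
lemma lintegral_chainDensity {f : ℕ → ℝ → ℝ≥0∞} {T : ℕ → ℝ → ℝ → ℝ≥0∞}
    (hf : ∀ k, Measurable (f k)) {n : ℕ} (hT : ∀ k < n, Measurable (Function.uncurry (T k)))
    (hmap : ∀ k < n, ∀ᵐ s, ∫⁻ x, f k x * T k x s = f (k + 1) s)
    (hone : ∀ k < n, ∀ᵐ x, f k x ≠ 0 → ∫⁻ s, T k x s = 1)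
    {g : ℝ → ℝ≥0∞} (hg : Measurable g) (i : Fin (n + 1)) :
    ∫⁻ x, chainDensity (f 0) T n x * g (x i) = ∫⁻ t, f i t * g t := by
  induction n generalizing g with
  | zero =>
    have hp := volume_preserving_funUnique (Fin 1) ℝ
    refine Eq.trans ?_ (hp.lintegral_comp (f := fun t => f i t * g t) ((hf _).mul hg))
    refine lintegral_congr fun x => ?_
    have : i = 0 := Fin.fin_one_eq_zero i
    subst this
    simp [chainDensity, MeasurableEquiv.funUnique]
  | succ n ih =>
    have ih' := fun {g : ℝ → ℝ≥0∞} (hg : Measurable g) (i : Fin (n + 1)) =>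
      ih (fun k hk => hT k (hk.trans n.lt_succ_self)) (fun k hk => hmap k (hk.trans n.lt_succ_self))
        (fun k hk => hone k (hk.trans n.lt_succ_self)) hg i
    have hmeas : ∀ m ≤ n + 1, Measurable (chainDensity (f 0) T m) := fun m hm =>
      measurable_chainDensity (hf 0) fun k hk => hT k (hk.trans_le hm)
    have hTn := hT n n.lt_succ_self
    refine (lintegral_eq_lintegral_snoc
      ((hmeas _ le_rfl).mul (hg.comp (measurable_pi_apply i)))).trans ?_
    simp only [Pi.mul_apply, Function.comp_apply]
    simp_rw [chainDensity_snoc]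
    have hTs : ∀ x, Measurable (T n x) := fun x => hTn.comp measurable_prodMk_left
    induction i using Fin.lastCases with
    | last =>
      simp only [Fin.snoc_last, Fin.val_last, mul_assoc]
      have hG : Measurable fun x => ∫⁻ s, T n x s * g s :=
        Measurable.lintegral_prod_right (hTn.mul (hg.comp measurable_snd))
      have h1 : ∀ y : Fin (n + 1) → ℝ,
          ∫⁻ s, chainDensity (f 0) T n y * (T n (y (Fin.last n)) s * g s) =
            chainDensity (f 0) T n y * ∫⁻ s, T n (y (Fin.last n)) s * g s :=
        fun y => lintegral_const_mul _ ((hTs _).mul hg)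
      simp_rw [h1]
      rw [ih' hG (Fin.last n)]
      have h2 : ∀ x, f n x * ∫⁻ s, T n x s * g s = ∫⁻ s, f n x * T n x s * g s := by
        intro x
        simp_rw [mul_assoc]
        exact (lintegral_const_mul _ ((hTs _).mul hg)).symm
      simp only [Fin.val_last]
      simp_rw [h2]
      rw [lintegral_lintegral_swap]
      · apply lintegral_congr_ae
        filter_upwards [hmap n n.lt_succ_self] with s hs
        rw [lintegral_mul_const, hs]
        exact (hf n).mul (hTn.comp measurable_prodMk_right)
      · exact ((((hf n).comp measurable_fst).mul hTn).mul (hg.comp measurable_snd)).aemeasurable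
    | cast j =>
      simp only [Fin.snoc_castSucc, Fin.val_castSucc]
      rw [← ih' hg j]
      have hr : Measurable fun x => ∫⁻ s, T n x s := Measurable.lintegral_prod_right hTn
      -- The induction hypothesis, tested on the indicator of the points where the kernel mass is
      -- not one, shows that the chain almost surely avoids them.
      have hbad : ∀ᵐ y, chainDensity (f 0) T n y ≠ 0 → ∫⁻ s, T n (y (Fin.last n)) s = 1 := by
        set B : Set ℝ := {x | ∫⁻ s, T n x s = 1}ᶜ with hB
        have hBm : MeasurableSet B := (measurableSet_eq_fun hr measurable_const).compl
        have h0 := ih' (measurable_one.indicator hBm) (Fin.last n)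
        have h1 : ∫⁻ t, f n t * B.indicator 1 t = 0 := by
          refine lintegral_eq_zero_of_ae_eq_zero ?_
          filter_upwards [hone n n.lt_succ_self] with t ht
          by_cases hft : f n t = 0
          · simp [hft]
          · simp [hB, ht hft]
        have hm : Measurable fun x => chainDensity (f 0) T n x * B.indicator 1 (x (Fin.last n)) :=
          (hmeas n n.le_succ).mul ((measurable_one.indicator hBm).comp (measurable_pi_apply _))
        rw [Fin.val_last, h1, lintegral_eq_zero_iff hm] at h0
        filter_upwards [h0] with y hy hne
        by_contra hc
        have : y (Fin.last n) ∈ B := hc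
        simp [this, hne] at hy
      apply lintegral_congr_ae
      filter_upwards [hbad] with y hy
      rw [lintegral_mul_const _ ((hTs _).const_mul _), lintegral_const_mul _ (hTs _)]
      by_cases hne : chainDensity (f 0) T n y = 0
      · simp [hne]
      · rw [hy hne, mul_one]

end Chain

/-! ### Factorisation of the `a_k` into transition densities. -/

section Factors

variable {n : ℕ} {δ : Fin (n + 1) → StieltjesFunction ℝ} {C : Measure (Fin (n + 1) → ℝ)}

lemma ext_one : ext δ 1 = δ 0 := ext_succ (δ := δ) 0

lemma ext_last : ext δ (n + 1) = δ (Fin.last n) := ext_succ (δ := δ) (Fin.last n)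

lemma Psi_one : Psi δ 1 = Ioo 0 (sInf {s ∈ Icc (0 : ℝ) 1 | δ 0 s = 1}) := by
  rw [Psi, if_pos rfl, ext_one]

lemma Psi_last : Psi δ (n + 2) = Ioo (sSup {s ∈ Icc (0 : ℝ) 1 | δ (Fin.last n) s = 0}) 1 := by
  rw [Psi, if_neg (by lia), if_pos rfl, ext_last]

lemma one_mem_setOf (hC : C ∈ copulasWith δ) :
    (1 : ℝ) ∈ {s ∈ Icc (0 : ℝ) 1 | δ 0 s = 1} :=
  ⟨by simp, apply_of_one_le hC 0 le_rfl⟩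

lemma zero_mem_setOf (hC : C ∈ copulasWith δ) :
    (0 : ℝ) ∈ {s ∈ Icc (0 : ℝ) 1 | δ (Fin.last n) s = 0} :=
  ⟨by simp, apply_of_nonpos hC _ le_rfl⟩

lemma Psi_castSucc_succ (i : Fin n) :
    Psi δ (i.val + 2) = gapSet (δ i.castSucc) (δ i.succ) :=
  Psi_succ (δ := δ) (i := i.castSucc) (j := i.succ) rfl

lemma K_castSucc_succ (i : Fin n) : K δ (i.val + 2) = cumHazard (δ i.castSucc) (δ i.succ) :=
  K_succ (δ := δ) (i := i.castSucc) (j := i.succ) rfl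

lemma gapPair_succ (hC : C ∈ copulasWith δ) (i : Fin n) : GapPair (δ i.castSucc) (δ i.succ) :=
  gapPair hC i.castSucc_le_succ

lemma lt_one_of_mem_Psi_one (hC : C ∈ copulasWith δ) {t s : ℝ} (ht : t ∈ Psi δ 1) (hs : s ≤ t) :
    δ 0 s < 1 := by
  rw [Psi_one] at ht
  refine ((δ 0).mono hs).trans_lt (lt_of_le_of_ne (mem_Icc_apply hC 0 t).2 fun h => ?_)
  have hle : sInf {s ∈ Icc (0 : ℝ) 1 | δ 0 s = 1} ≤ 1 :=
    csInf_le ⟨0, fun x hx => hx.1.1⟩ (one_mem_setOf hC)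
  have : sInf {s ∈ Icc (0 : ℝ) 1 | δ 0 s = 1} ≤ t :=
    csInf_le ⟨0, fun x hx => hx.1.1⟩ ⟨⟨ht.1.le, (ht.2.trans_le hle).le⟩, h⟩
  exact this.not_gt ht.2

/-- With `δ_(0) = 1` the rate is a logarithmic derivative, and the base point `0` contributes
nothing since `δ_(1)(0) = 0`. -/
lemma K_one (hC : C ∈ copulasWith δ) {t : ℝ} (ht : t ∈ Psi δ 1) :
    K δ 1 t = -Real.log (1 - δ 0 t) := by
  have ht0 : 0 ≤ t := (Psi_one (δ := δ) ▸ ht).1.le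
  have h1 : K δ 1 t = ∫ s in (0 : ℝ)..t, deriv (δ 0) s / (1 - δ 0 s) := by
    rw [K, if_neg (by lia), mid, if_pos rfl, ext_one]
    rfl
  have hac : AbsolutelyContinuousOnInterval (δ 0) 0 t :=
    ((lipschitzWith_apply hC 0).lipschitzOnWith (s := uIcc 0 t)).absolutelyContinuousOnInterval
  have hac2 : AbsolutelyContinuousOnInterval (fun s => -Real.log (1 - δ 0 s)) 0 t := by
    -- On `[0, t]` the values stay below `δ 0 t < 1`, away from the singularity of the logarithm.
    refine hac.contDiffOn_comp (g := fun y => -Real.log (1 - y)) (m := 0) (M := δ 0 t) ?_ ?_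
    · intro s hs
      rw [uIcc_of_le ht0] at hs
      exact ⟨(mem_Icc_apply hC 0 s).1, (δ 0).mono hs.2⟩
    · refine ((contDiffOn_const.sub contDiffOn_id).log fun y hy => ?_).neg
      exact (sub_pos.2 (hy.2.trans_lt (lt_one_of_mem_Psi_one hC ht le_rfl))).ne'
  rw [h1]
  trans ∫ s in (0 : ℝ)..t, deriv (fun s => -Real.log (1 - δ 0 s)) s
  · apply intervalIntegral.integral_congr_ae
    filter_upwards [hac.ae_differentiableAt] with s hs hs'
    have hs2 := uIoc_subset_uIcc hs'
    have hlt : 0 < 1 - δ 0 s :=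
      sub_pos.2 (lt_one_of_mem_Psi_one hC ht (by rw [uIcc_of_le ht0] at hs2; exact hs2.2))
    have := ((((hs hs2).hasDerivAt).const_sub 1).log hlt.ne').neg.deriv
    rw [show deriv (fun s => -Real.log (1 - δ 0 s)) s = _ from this]
    ring
  · rw [hac2.integral_deriv_eq_sub, apply_of_nonpos hC 0 le_rfl]
    simp

lemma isOpen_Psi (hC : C ∈ copulasWith δ) (i : Fin (n + 2)) : IsOpen (Psi δ (i.val + 1)) := by
  induction i using Fin.lastCases with
  | last => rw [Fin.val_last, Psi_last]; exact isOpen_Ioo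
  | cast i =>
    induction i using Fin.cases with
    | zero => simp [Psi_one, isOpen_Ioo]
    | succ i => simpa [Psi_castSucc_succ, add_assoc] using (gapPair_succ hC i).isOpen_gapSet

lemma Psi_subset (hC : C ∈ copulasWith δ) (i : Fin (n + 2)) :
    Psi δ (i.val + 1) ⊆ Icc 0 1 := by
  induction i using Fin.lastCases with
  | last =>
    rw [Fin.val_last, Psi_last]
    refine Ioo_subset_Icc_self.trans (Icc_subset_Icc_left ?_)
    exact le_csSup ⟨1, fun x hx => hx.1.2⟩ (zero_mem_setOf hC)
  | cast i =>
    induction i using Fin.cases with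
    | zero =>
      simp only [Fin.castSucc_zero, Fin.val_zero, zero_add, Psi_one]
      refine Ioo_subset_Icc_self.trans (Icc_subset_Icc_right ?_)
      exact csInf_le ⟨0, fun x hx => hx.1.1⟩ (one_mem_setOf hC)
    | succ i => simpa [Psi_castSucc_succ, add_assoc] using (gapPair_succ hC i).gapSet_subset

lemma continuousOn_K (hC : C ∈ copulasWith δ) (i : Fin (n + 2)) :
    ContinuousOn (K δ (i.val + 1)) (Psi δ (i.val + 1)) := by
  induction i using Fin.lastCases with
  | last => rw [Fin.val_last, K_last]; exact continuousOn_const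
  | cast i =>
    induction i using Fin.cases with
    | zero =>
      simp only [Fin.castSucc_zero, Fin.val_zero, zero_add]
      refine ContinuousOn.congr (f := fun t => -Real.log (1 - δ 0 t)) ?_ fun t ht => K_one hC ht
      refine ContinuousOn.neg (ContinuousOn.log ?_ fun t ht => ?_)
      · exact (continuous_const.sub (lipschitzWith_apply hC 0).continuous).continuousOn
      · exact (sub_pos.2 (lt_one_of_mem_Psi_one hC ht le_rfl)).ne'
    | succ i =>
      simpa [Psi_castSucc_succ, K_castSucc_succ, add_assoc]
        using (gapPair_succ hC i).continuousOn_cumHazard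

lemma deriv_K_nonneg (hC : C ∈ copulasWith δ) (i : Fin (n + 1)) {t : ℝ}
    (ht : t ∈ Psi δ (i.val + 1)) : 0 ≤ deriv (K δ (i.val + 1)) t := by
  induction i using Fin.cases with
  | zero =>
    simp only [Fin.val_zero, zero_add] at ht ⊢
    have hm : MonotoneOn (K δ 1) (Psi δ 1) := by
      intro x hx y hy hxy
      rw [K_one hC hx, K_one hC hy]
      refine neg_le_neg (Real.log_le_log (sub_pos.2 (lt_one_of_mem_Psi_one hC hy le_rfl)) ?_)
      exact sub_le_sub_left ((δ 0).mono hxy) _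
    rw [← derivWithin_of_mem_nhds ((isOpen_Psi hC 0).mem_nhds ht)]
    exact hm.derivWithin_nonneg
  | succ i =>
    simp only [Fin.val_succ, add_assoc, Nat.reduceAdd, K_castSucc_succ, Psi_castSucc_succ] at ht ⊢
    exact (gapPair_succ hC i).deriv_cumHazard_nonneg ht

/-- The factor `K_{k+1}' exp (-K_{k+1})` of `a_{k+1}`. -/
noncomputable def incoming {d : ℕ} (δ : Fin d → StieltjesFunction ℝ) (k : ℕ) : ℝ → ℝ :=
  (Psi δ (k + 1)).indicator fun t => deriv (K δ (k + 1)) t * Real.exp (-K δ (k + 1) t)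

/-- The factor `exp K_{k+2}` of `a_{k+1}`. -/
noncomputable def outgoing {d : ℕ} (δ : Fin d → StieltjesFunction ℝ) (k : ℕ) : ℝ → ℝ :=
  (Psi δ (k + 2)).indicator fun t => Real.exp (K δ (k + 2) t)

/-- Splitting every `a_k` allows the outgoing factor at one coordinate to be paired with the
incoming factor at the next. -/
lemma a_eq_mul {d : ℕ} (δ : Fin d → StieltjesFunction ℝ) (k : ℕ) (t : ℝ) :
    a δ (k + 1) t = incoming δ k t * outgoing δ k t := by
  rw [incoming, outgoing, ← inter_indicator_mul, a]
  congr 1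
  ext t
  rw [sub_eq_neg_add, Real.exp_add, mul_assoc]

lemma incoming_nonneg (hC : C ∈ copulasWith δ) (i : Fin (n + 1)) (t : ℝ) :
    0 ≤ incoming δ i t :=
  indicator_nonneg (fun _ ht => mul_nonneg (deriv_K_nonneg hC i ht) (Real.exp_nonneg _)) t

lemma outgoing_nonneg (k : ℕ) (t : ℝ) : 0 ≤ outgoing δ k t :=
  indicator_nonneg (fun _ _ => Real.exp_nonneg _) t

lemma measurable_indicator_of_continuousOn {O : Set ℝ} {f : ℝ → ℝ} (hO : IsOpen O)
    (hf : ContinuousOn f O) : Measurable (O.indicator f) := by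
  classical
  rw [← piecewise_eq_indicator]
  exact hf.measurable_piecewise continuousOn_const hO.measurableSet

lemma measurable_incoming (hC : C ∈ copulasWith δ) (i : Fin (n + 1)) :
    Measurable (incoming δ i) := by
  have h : incoming δ i = fun t => deriv (K δ (i.val + 1)) t *
      (Psi δ (i.val + 1)).indicator (fun t => Real.exp (-K δ (i.val + 1) t)) t := by
    ext t
    by_cases ht : t ∈ Psi δ (i.val + 1) <;> simp [incoming, ht]
  rw [h]
  refine (measurable_deriv _).mul (measurable_indicator_of_continuousOn ?_ ?_)
  · exact isOpen_Psi hC i.castSucc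
  · exact (continuousOn_K hC i.castSucc).neg.rexp

lemma measurable_outgoing (hC : C ∈ copulasWith δ) (i : Fin (n + 1)) :
    Measurable (outgoing δ i) :=
  measurable_indicator_of_continuousOn (isOpen_Psi hC i.succ) (continuousOn_K hC i.succ).rexp

/-- The transition density of the order statistics. -/
noncomputable def transition {d : ℕ} (δ : Fin d → StieltjesFunction ℝ) (k : ℕ) (x s : ℝ) : ℝ≥0∞ :=
  {p : ℝ × ℝ | p.1 < p.2 ∧ Ioo p.1 p.2 ⊆ Psi δ (k + 2)}.indicator
    (fun p => ENNReal.ofReal (outgoing δ k p.1) * ENNReal.ofReal (incoming δ (k + 1) p.2)) (x, s)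

/-- Failure means that some `r` outside `O` lies strictly between the two coordinates, an open
condition for each `r`. -/
lemma isClosed_setOf_Ioo_subset (O : Set ℝ) : IsClosed {p : ℝ × ℝ | Ioo p.1 p.2 ⊆ O} := by
  have : {p : ℝ × ℝ | Ioo p.1 p.2 ⊆ O}ᶜ = ⋃ r ∈ Oᶜ, {p : ℝ × ℝ | p.1 < r ∧ r < p.2} := by
    ext p
    simp only [mem_compl_iff, mem_ofPred_eq, not_subset, mem_Ioo, mem_iUnion, exists_prop]
    exact ⟨fun ⟨r, h1, h2⟩ => ⟨r, h2, h1⟩, fun ⟨r, h1, h2⟩ => ⟨r, h2, h1⟩⟩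
  rw [← isOpen_compl_iff, this]
  exact isOpen_biUnion fun r _ =>
    (isOpen_lt continuous_fst continuous_const).inter (isOpen_lt continuous_const continuous_snd)

lemma measurable_transition (hC : C ∈ copulasWith δ) {k : ℕ} (hk : k < n) :
    Measurable (Function.uncurry (transition δ k)) := by
  refine Measurable.indicator ?_ ?_
  · exact ((measurable_outgoing hC ⟨k, by lia⟩).comp measurable_fst).ennreal_ofReal.mul
      ((measurable_incoming hC ⟨k + 1, by lia⟩).comp measurable_snd).ennreal_ofReal
  · exact (measurableSet_lt measurable_fst measurable_snd).inter
      (isClosed_setOf_Ioo_subset _).measurableSet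

/-- Each `δ_(k)` with `2 ≤ k ≤ d` charges only `Ψ_k`. -/
def ChargesGaps {d : ℕ} (δ : Fin d → StieltjesFunction ℝ) : Prop :=
  ∀ i j : Fin d, i.val + 1 = j.val → (δ j).measure (gapSet (δ i) (δ j))ᶜ = 0

lemma ae_deriv_eq_zero_of_notMem_left (hC : C ∈ copulasWith δ) (hN : ChargesGaps δ) (i : Fin n) :
    ∀ᵐ t, t ∉ gapSet (δ i.castSucc) (δ i.succ) → deriv (δ i.succ) t = 0 :=
  deriv_eq_zero_of_ae hC i.succ (hN i.castSucc i.succ rfl)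

/-- Off the gap set the difference of the two distribution functions attains its minimum zero, so
their derivatives agree where both exist; the smaller one has derivative zero there by
`ChargesGaps`. -/
lemma ae_deriv_eq_zero_of_notMem_right (hC : C ∈ copulasWith δ) (hN : ChargesGaps δ) (i : Fin n) :
    ∀ᵐ t, t ∉ gapSet (δ i.castSucc) (δ i.succ) → deriv (δ i.castSucc) t = 0 := by
  filter_upwards [ae_deriv_eq_zero_of_notMem_left hC hN i, (δ i.castSucc).ae_hasDerivAt,
    (δ i.succ).ae_hasDerivAt] with t h0 h1 h2 ht
  have hg := gapPair_succ hC i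
  have hmin : IsLocalMin (fun s => δ i.castSucc s - δ i.succ s) t := by
    refine .of_forall fun s => ?_
    simp only [hg.eq_of_notMem ht, sub_self]
    exact sub_nonneg.2 (hg.le s)
  have h3 := hmin.hasDerivAt_eq_zero (h1.sub h2)
  rw [h1.deriv, sub_eq_zero.1 h3, ← h2.deriv, h0 ht]

/-- Unlike the intermediate gaps, the two extreme sets carry their laws without assuming
`ChargesGaps`: their end points only trim intervals where the distribution function is constant. -/
lemma measure_compl_Psi_one (hC : C ∈ copulasWith δ) : (δ 0).measure (Psi δ 1)ᶜ = 0 := by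
  have := isProbabilityMeasure_measure hC 0
  have := nullSingletonClass_measure hC 0
  set S := {s ∈ Icc (0 : ℝ) 1 | δ 0 s = 1} with hS
  have hcl : IsClosed S := isClosed_Icc.inter
    (isClosed_eq (lipschitzWith_apply hC 0).continuous continuous_const)
  have hmem : sInf S ∈ S := hcl.csInf_mem ⟨1, one_mem_setOf hC⟩ ⟨0, fun x hx => hx.1.1⟩
  have h1 : (δ 0).measure (Iic 0) = 0 := by
    have := eq_measureReal_Iic hC 0 0
    rw [apply_of_nonpos hC 0 le_rfl, eq_comm, measureReal_eq_zero_iff] at this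
    exact this
  have h2 : (δ 0).measure (Ici (sInf S)) = 0 := by
    rw [← measure_congr Ioi_ae_eq_Ici, ← compl_Iic, prob_compl_eq_zero_iff measurableSet_Iic]
    have := eq_measureReal_Iic hC 0 (sInf S)
    rw [hmem.2, measureReal_def, eq_comm, ENNReal.toReal_eq_one_iff] at this
    exact this
  refine measure_mono_null (fun t ht => ?_) (measure_union_null h1 h2)
  rw [Psi_one] at ht
  by_contra h
  rw [mem_union, not_or] at h
  exact ht ⟨not_le.1 h.1, not_le.1 h.2⟩

lemma measure_compl_Psi_last (hC : C ∈ copulasWith δ) :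
    (δ (Fin.last n)).measure (Psi δ (n + 2))ᶜ = 0 := by
  have := isProbabilityMeasure_measure hC (Fin.last n)
  have := nullSingletonClass_measure hC (Fin.last n)
  set S := {s ∈ Icc (0 : ℝ) 1 | δ (Fin.last n) s = 0} with hS
  have hcl : IsClosed S := isClosed_Icc.inter
    (isClosed_eq (lipschitzWith_apply hC _).continuous continuous_const)
  have hmem : sSup S ∈ S := hcl.csSup_mem ⟨0, zero_mem_setOf hC⟩ ⟨1, fun x hx => hx.1.2⟩
  have h1 : (δ (Fin.last n)).measure (Iic (sSup S)) = 0 := by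
    have := eq_measureReal_Iic hC (Fin.last n) (sSup S)
    rw [hmem.2, eq_comm, measureReal_eq_zero_iff] at this
    exact this
  have h2 : (δ (Fin.last n)).measure (Ici 1) = 0 := by
    rw [← measure_congr Ioi_ae_eq_Ici, ← compl_Iic, prob_compl_eq_zero_iff measurableSet_Iic]
    have := eq_measureReal_Iic hC (Fin.last n) 1
    rw [apply_of_one_le hC _ le_rfl, measureReal_def, eq_comm, ENNReal.toReal_eq_one_iff] at this
    exact this
  refine measure_mono_null (fun t ht => ?_) (measure_union_null h1 h2)
  rw [Psi_last] at ht
  by_contra h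
  rw [mem_union, not_or] at h
  exact ht ⟨not_le.1 h.1, not_le.1 h.2⟩

/-- `δ_(k)` charges only `Ψ_k`. -/
lemma measure_compl_Psi (hC : C ∈ copulasWith δ) (hN : ChargesGaps δ) (i : Fin (n + 1)) :
    (δ i).measure (Psi δ (i.val + 1))ᶜ = 0 := by
  induction i using Fin.cases with
  | zero => exact measure_compl_Psi_one hC
  | succ i => simpa [add_assoc, Psi_castSucc_succ] using hN i.castSucc i.succ rfl

/-- `δ_(k)` charges only `Ψ_{k+1}`. -/
lemma measure_compl_Psi_succ (hC : C ∈ copulasWith δ) (hN : ChargesGaps δ) (i : Fin (n + 1)) :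
    (δ i).measure (Psi δ (i.val + 2))ᶜ = 0 := by
  induction i using Fin.lastCases with
  | last => exact measure_compl_Psi_last hC
  | cast i =>
    rw [measure_eq_withDensity hC, withDensity_apply_eq_zero
      (measurable_deriv _).ennreal_ofReal, Fin.val_castSucc, Psi_castSucc_succ]
    refine measure_mono_null ?_ (ae_iff.1 (ae_deriv_eq_zero_of_notMem_right hC hN i))
    rintro t ⟨h1, h2⟩
    simp only [ne_eq, ENNReal.ofReal_eq_zero, not_le, mem_ofPred_eq] at h1
    simp only [mem_ofPred_eq, Classical.not_imp]
    exact ⟨h2, h1.ne'⟩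

/-- The value of `K_k' exp (-K_k)`. -/
lemma ae_incoming_zero (hC : C ∈ copulasWith δ) :
    ∀ᵐ t, incoming δ 0 t = deriv (δ 0) t := by
  filter_upwards [deriv_eq_zero_of_ae hC 0 (measure_compl_Psi_one hC), (δ 0).ae_hasDerivAt]
    with t h1 h2
  by_cases ht : t ∈ Psi δ 1
  · have hlt : 0 < 1 - δ 0 t := sub_pos.2 (lt_one_of_mem_Psi_one hC ht le_rfl)
    have h3 : HasDerivAt (K δ 1) (deriv (δ 0) t / (1 - δ 0 t)) t := by
      have h4 := ((h2.const_sub 1).log hlt.ne').neg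
      rw [← h2.deriv, neg_div, neg_neg] at h4
      refine h4.congr_of_eventuallyEq ?_
      filter_upwards [(isOpen_Psi hC 0).mem_nhds ht] with s hs using K_one hC hs
    rw [incoming, indicator_of_mem ht, zero_add, h3.deriv, K_one hC ht, neg_neg, Real.exp_log hlt]
    field_simp
  · rw [incoming, indicator_of_notMem ht, h1 ht]

lemma ae_incoming_succ (hC : C ∈ copulasWith δ) (i : Fin n) :
    ∀ᵐ t, t ∈ gapSet (δ i.castSucc) (δ i.succ) → incoming δ (i.val + 1) t =
      hazard (δ i.castSucc) (δ i.succ) t *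
        Real.exp (-cumHazard (δ i.castSucc) (δ i.succ) t) := by
  filter_upwards [(gapPair_succ hC i).ae_hasDerivAt_cumHazard] with t h1 ht
  rw [incoming, indicator_of_mem, K_castSucc_succ, (h1 ht).deriv]
  rwa [Psi_castSucc_succ]

lemma ae_incoming_eq_zero (hC : C ∈ copulasWith δ) (i : Fin (n + 1)) :
    ∀ᵐ t, deriv (δ i) t = 0 → incoming δ i t = 0 := by
  induction i using Fin.cases with
  | zero =>
    filter_upwards [ae_incoming_zero hC] with t ht h0
    rw [← h0]
    exact ht
  | succ i =>
    filter_upwards [ae_incoming_succ hC i] with t ht h0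
    by_cases h : t ∈ gapSet (δ i.castSucc) (δ i.succ)
    · rw [Fin.val_succ, ht h, hazard, h0, zero_div, zero_mul]
    · rw [Fin.val_succ, incoming, indicator_of_notMem]
      rwa [Psi_castSucc_succ]

/-- As `K_{d+1} = 0`, the last outgoing factor is the indicator of `Ψ_{d+1}`. Off that set `δ_(d)' =
0` almost everywhere, which kills the incoming factor, so the indicator can be dropped. -/
lemma ae_incoming_last (hC : C ∈ copulasWith δ) :
    ∀ᵐ t, incoming δ n t = 0 ∨ outgoing δ n t = 1 := by
  filter_upwards [ae_incoming_eq_zero hC (Fin.last n),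
    deriv_eq_zero_of_ae hC (Fin.last n) (measure_compl_Psi_last hC)] with t h1 h2
  by_cases ht : t ∈ Psi δ (n + 2)
  · right
    simp [outgoing, ht, K_last]
  · exact .inl (h1 (h2 ht))

lemma outgoing_castSucc {i : Fin n} {t : ℝ} (ht : t ∈ gapSet (δ i.castSucc) (δ i.succ)) :
    outgoing δ i t = Real.exp (cumHazard (δ i.castSucc) (δ i.succ) t) := by
  rw [outgoing, K_castSucc_succ, indicator_of_mem]
  rwa [Psi_castSucc_succ]

lemma incoming_eq_zero_of_notMem {i : Fin n} {t : ℝ}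
    (ht : t ∉ gapSet (δ i.castSucc) (δ i.succ)) : incoming δ (i.val + 1) t = 0 := by
  rw [incoming, indicator_of_notMem]
  rwa [Psi_castSucc_succ]

lemma outgoing_eq_zero_of_notMem {i : Fin n} {t : ℝ}
    (ht : t ∉ gapSet (δ i.castSucc) (δ i.succ)) : outgoing δ i t = 0 := by
  rw [outgoing, indicator_of_notMem]
  rwa [Psi_castSucc_succ]

/-- Requiring `x` to lie in the gap set costs nothing, as the outgoing factor vanishes off it; the
support then has the form treated for gap pairs. -/
lemma transition_eq_indicator (i : Fin n) (x s : ℝ) : transition δ i x s =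
    {x | x < s ∧ x ∈ gapSet (δ i.castSucc) (δ i.succ) ∧
      Ioo x s ⊆ gapSet (δ i.castSucc) (δ i.succ)}.indicator
      (fun x => ENNReal.ofReal (outgoing δ i x) * ENNReal.ofReal (incoming δ (i.val + 1) s)) x := by
  rw [transition, Psi_castSucc_succ]
  by_cases h1 : x < s ∧ Ioo x s ⊆ gapSet (δ i.castSucc) (δ i.succ)
  · rw [indicator_of_mem (by exact h1)]
    by_cases h2 : x ∈ gapSet (δ i.castSucc) (δ i.succ)
    · rw [indicator_of_mem]
      exact ⟨h1.1, h2, h1.2⟩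
    · rw [indicator_of_notMem fun h => h2 h.2.1, outgoing_eq_zero_of_notMem h2]
      simp
  · rw [indicator_of_notMem (by exact h1), indicator_of_notMem fun h => h1 ⟨h.1, h.2.2⟩]

lemma transition_eq_indicator_right (i : Fin n) (x s : ℝ) : transition δ i x s =
    {s | x < s ∧ s ∈ gapSet (δ i.castSucc) (δ i.succ) ∧
      Ioo x s ⊆ gapSet (δ i.castSucc) (δ i.succ)}.indicator
      (fun s => ENNReal.ofReal (outgoing δ i x) * ENNReal.ofReal (incoming δ (i.val + 1) s)) s := by
  rw [transition, Psi_castSucc_succ]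
  by_cases h1 : x < s ∧ Ioo x s ⊆ gapSet (δ i.castSucc) (δ i.succ)
  · rw [indicator_of_mem (by exact h1)]
    by_cases h2 : s ∈ gapSet (δ i.castSucc) (δ i.succ)
    · rw [indicator_of_mem]
      exact ⟨h1.1, h2, h1.2⟩
    · rw [indicator_of_notMem fun h => h2 h.2.1, incoming_eq_zero_of_notMem h2]
      simp
  · rw [indicator_of_notMem (by exact h1), indicator_of_notMem fun h => h1 ⟨h.1, h.2.2⟩]

/-- On the gap set the rate times the gap is the next density. Off it the kernel vanishes, and
`ChargesGaps` makes the next density vanish almost everywhere as well. -/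
lemma lintegral_deriv_mul_transition (hC : C ∈ copulasWith δ) (hN : ChargesGaps δ) (i : Fin n) :
    ∀ᵐ s, ∫⁻ x, ENNReal.ofReal (deriv (δ i.castSucc) x) * transition δ i x s =
      ENNReal.ofReal (deriv (δ i.succ) s) := by
  have hg := gapPair_succ hC i
  filter_upwards [ae_incoming_succ hC i, ae_deriv_eq_zero_of_notMem_left hC hN i] with s h1 h2
  by_cases hs : s ∈ gapSet (δ i.castSucc) (δ i.succ)
  · obtain ⟨g, -, -, hset⟩ := hg.setOf_Ioo_subset_left hs
    have hm : MeasurableSet {x | x < s ∧ x ∈ gapSet (δ i.castSucc) (δ i.succ) ∧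
        Ioo x s ⊆ gapSet (δ i.castSucc) (δ i.succ)} := hset ▸ measurableSet_Ioo
    have hpos : 0 < δ i.castSucc s - δ i.succ s := sub_pos.2 hs
    have h3 : ∀ x, ENNReal.ofReal (deriv (δ i.castSucc) x) * transition δ i x s =
        ENNReal.ofReal (hazard (δ i.castSucc) (δ i.succ) s) *
        {x | x < s ∧ x ∈ gapSet (δ i.castSucc) (δ i.succ) ∧
          Ioo x s ⊆ gapSet (δ i.castSucc) (δ i.succ)}.indicator (fun x =>
        ENNReal.ofReal (deriv (δ i.castSucc) x *
          Real.exp (cumHazard (δ i.castSucc) (δ i.succ) x -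
            cumHazard (δ i.castSucc) (δ i.succ) s))) x := by
      intro x
      rw [transition_eq_indicator]
      by_cases hx : x ∈ {x | x < s ∧ x ∈ gapSet (δ i.castSucc) (δ i.succ) ∧
          Ioo x s ⊆ gapSet (δ i.castSucc) (δ i.succ)}
      · rw [indicator_of_mem hx, indicator_of_mem hx, outgoing_castSucc hx.2.1, h1 hs,
          ← ENNReal.ofReal_mul (Real.exp_nonneg _), ← ENNReal.ofReal_mul (deriv_nonneg_apply _ _),
          ← ENNReal.ofReal_mul (hg.hazard_nonneg s), sub_eq_add_neg, Real.exp_add]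
        congr 1
        ring
      · rw [indicator_of_notMem hx, indicator_of_notMem hx, mul_zero, mul_zero]
    simp_rw [h3]
    rw [lintegral_const_mul' _ _ ENNReal.ofReal_ne_top, lintegral_indicator hm,
      hg.lintegral_deriv_left_mul_exp hs, ← ENNReal.ofReal_mul (hg.hazard_nonneg s), hazard,
      div_mul_cancel₀ _ hpos.ne']
  · rw [h2 hs, ENNReal.ofReal_zero]
    simp_rw [transition_eq_indicator, incoming_eq_zero_of_notMem hs]
    simp

lemma lintegral_transition (hC : C ∈ copulasWith δ) {i : Fin n} {x : ℝ}
    (hx : x ∈ gapSet (δ i.castSucc) (δ i.succ)) : ∫⁻ s, transition δ i x s = 1 := by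
  have hg := gapPair_succ hC i
  obtain ⟨e, -, -, hset⟩ := hg.setOf_Ioo_subset_right hx
  have hm : MeasurableSet {s | x < s ∧ s ∈ gapSet (δ i.castSucc) (δ i.succ) ∧
      Ioo x s ⊆ gapSet (δ i.castSucc) (δ i.succ)} := hset ▸ measurableSet_Ioo
  simp_rw [transition_eq_indicator_right]
  rw [lintegral_indicator hm, ← hg.lintegral_hazard_mul_exp hx]
  apply setLIntegral_congr_fun_ae hm
  filter_upwards [ae_incoming_succ hC i] with s h1 hs
  rw [outgoing_castSucc hx, h1 hs.2.1, ← ENNReal.ofReal_mul (Real.exp_nonneg _), sub_eq_add_neg,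
    Real.exp_add]
  congr 1
  ring

end Factors

/-! ### `C_δ` is a symmetric copula with multidiagonal `δ`. -/

section MaxEnt

variable {n : ℕ} {δ : Fin (n + 1) → StieltjesFunction ℝ} {C : Measure (Fin (n + 1) → ℝ)}

lemma a_nonneg (hC : C ∈ copulasWith δ) (i : Fin (n + 1)) (t : ℝ) : 0 ≤ a δ (i.val + 1) t := by
  rw [a_eq_mul]
  exact mul_nonneg (incoming_nonneg hC i t) (outgoing_nonneg _ t)

lemma density_nonneg (hC : C ∈ copulasWith δ) (u : Fin (n + 1) → ℝ) : 0 ≤ density δ u :=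
  indicator_nonneg (fun _ _ => mul_nonneg (by positivity)
    (Finset.prod_nonneg fun i _ => a_nonneg hC i _)) u

/-- An order statistic is one of the coordinates, so it suffices that all coordinates satisfy all
the properties. -/
lemma ae_forall_orderStat {d : ℕ} {p : Fin d → ℝ → Prop} (hp : ∀ i, ∀ᵐ t, p i t) :
    ∀ᵐ u : Fin d → ℝ, ∀ i, p i (orderStat u i) := by
  have h : ∀ i j : Fin d, ∀ᵐ u : Fin d → ℝ, p i (u j) := fun i j =>
    (Measure.quasiMeasurePreserving_eval (fun _ : Fin d => (volume : Measure ℝ)) j).ae (hp i)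
  have h2 : ∀ᵐ u : Fin d → ℝ, ∀ i j, p i (u j) := by
    simp only [ae_all_iff]
    exact h
  filter_upwards [h2] with u hu i
  exact hu i _

lemma measurableSet_L (δ : Fin (n + 1) → StieltjesFunction ℝ) : MeasurableSet (L δ) := by
  have h1 : MeasurableSet {u : Fin (n + 1) → ℝ | ∀ i, u i ∈ Icc (0 : ℝ) 1} := by
    rw [show {u : Fin (n + 1) → ℝ | ∀ i, u i ∈ Icc (0 : ℝ) 1} =
      ⋂ i, {u | u i ∈ Icc (0 : ℝ) 1} by ext; simp]
    exact MeasurableSet.iInter fun i => measurable_pi_apply i measurableSet_Icc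
  rw [show L δ = {u : Fin (n + 1) → ℝ | ∀ i, u i ∈ Icc (0 : ℝ) 1} ∩
      ⋂ i, ⋂ j : Fin (n + 1), ⋂ (_ : i.val + 1 = j.val),
        {u | Ioo (orderStat u i) (orderStat u j) ⊆ Psi δ (j.val + 1)} by
    ext; simp [L]]
  refine h1.inter ?_
  refine MeasurableSet.iInter fun i => MeasurableSet.iInter fun j => MeasurableSet.iInter fun _ => ?_
  have : Measurable fun u : Fin (n + 1) → ℝ => (orderStat u i, orderStat u j) := by fun_prop
  exact this (isClosed_setOf_Ioo_subset (Psi δ (j.val + 1))).measurableSet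

lemma measurable_a (hC : C ∈ copulasWith δ) (i : Fin (n + 1)) : Measurable (a δ (i.val + 1)) := by
  rw [funext (a_eq_mul δ i.val)]
  exact (measurable_incoming hC i).mul (measurable_outgoing hC i)

lemma measurable_density (hC : C ∈ copulasWith δ) : Measurable (density δ) := by
  refine Measurable.indicator (measurable_const.mul ?_) (measurableSet_L δ)
  exact Finset.measurable_prod _ fun i _ => (measurable_a hC i).comp (measurable_orderStat_apply i)

lemma mem_L_iff {u : Fin (n + 1) → ℝ} (hu : ∀ i, orderStat u i ∈ Icc (0 : ℝ) 1) :
    u ∈ L δ ↔ ∀ i : Fin n,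
      Ioo (orderStat u i.castSucc) (orderStat u i.succ) ⊆ Psi δ (i.val + 2) := by
  constructor
  · exact fun h i => h.2 i.castSucc i.succ rfl
  · intro h
    refine ⟨fun i => ?_, fun i j hij => ?_⟩
    · have := hu ((Tuple.sort u).symm i)
      rwa [orderStat, Function.comp_apply, Equiv.apply_symm_apply] at this
    · have hi : i.val < n := by lia
      have h1 : i = (⟨i.val, hi⟩ : Fin n).castSucc := rfl
      have h2 : j = (⟨i.val, hi⟩ : Fin n).succ := Fin.ext hij.symm
      rw [h1, h2]
      exact h _

/-- A shift of index pairs neighbours. The two unpaired factors are the first incoming one, which is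
the initial density, and the last outgoing one, which is `1` unless the product is zero anyway. -/
lemma prod_a_eq {x : Fin (n + 1) → ℝ} (h0 : incoming δ 0 (x 0) = deriv (δ 0) (x 0))
    (hn : incoming δ n (x (Fin.last n)) = 0 ∨ outgoing δ n (x (Fin.last n)) = 1) :
    ∏ i : Fin (n + 1), a δ (i.val + 1) (x i) =
      deriv (δ 0) (x 0) * ∏ i : Fin n, (outgoing δ i (x i.castSucc) *
        incoming δ (i.val + 1) (x i.succ)) := by
  have h1 : ∏ i : Fin (n + 1), incoming δ i (x i) =
      deriv (δ 0) (x 0) * ∏ i : Fin n, incoming δ (i.val + 1) (x i.succ) := by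
    rw [Fin.prod_univ_succ, ← h0]
    rfl
  have h2 : ∏ i : Fin (n + 1), outgoing δ i (x i) =
      (∏ i : Fin n, outgoing δ i (x i.castSucc)) * outgoing δ n (x (Fin.last n)) := by
    rw [Fin.prod_univ_castSucc]
    rfl
  simp_rw [a_eq_mul]
  rw [Finset.prod_mul_distrib, Finset.prod_mul_distrib, mul_left_comm, ← h1, h2]
  rcases hn with hn | hn
  · rw [Finset.prod_eq_zero (Finset.mem_univ (Fin.last n)) hn, zero_mul, mul_zero]
  · rw [hn, mul_one, mul_comm]

/-- Almost everywhere, `c_δ` is `1 / d!` times the density of a Markov chain, evaluated at the order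
statistics. -/
lemma ae_ofReal_density (hC : C ∈ copulasWith δ) :
    ∀ᵐ u, ENNReal.ofReal (density δ u) = ENNReal.ofReal (1 / ((n + 1) ! : ℝ)) *
      chainDensity (fun t => ENNReal.ofReal (deriv (δ 0) t)) (transition δ) n (orderStat u) := by
  have hp : ∀ i : Fin (n + 1), ∀ᵐ t, incoming δ 0 t = deriv (δ 0) t ∧
      (incoming δ n t = 0 ∨ outgoing δ n t = 1) := fun i => by
    filter_upwards [ae_incoming_zero hC, ae_incoming_last hC] with t h1 h2 using ⟨h1, h2⟩
  filter_upwards [ae_forall_orderStat hp, ae_injective] with u hu hinj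
  have hlt := strictMono_orderStat hinj
  generalize hx : orderStat u = x at hu hlt
  have e1 := prod_a_eq (hu 0).1 (hu (Fin.last n)).2
  by_cases hgap : ∀ i : Fin n, Ioo (x i.castSucc) (x i.succ) ⊆ Psi δ (i.val + 2)
  · have e2 : density δ u = 1 / ((n + 1) ! : ℝ) * ∏ i : Fin (n + 1), a δ (i.val + 1) (x i) := by
      by_cases hI : ∀ i, x i ∈ Icc (0 : ℝ) 1
      · rw [density, indicator_of_mem, hx]
        rwa [mem_L_iff (hx ▸ hI), hx]
      · push Not at hI
        obtain ⟨i, hi⟩ := hI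
        -- The sets `Ψ_k` lie in `[0, 1]`, so the condition in `L` that `u` belong to the cube is
        -- automatic wherever the product is non-zero.
        have h0 : ∏ i : Fin (n + 1), a δ (i.val + 1) (x i) = 0 := by
          refine Finset.prod_eq_zero (Finset.mem_univ i) ?_
          rw [a, indicator_of_notMem]
          exact fun h => hi (Psi_subset hC i.castSucc h.1)
        rw [h0, mul_zero, density]
        by_cases hL : u ∈ L δ
        · rw [indicator_of_mem hL, hx, h0, mul_zero]
        · rw [indicator_of_notMem hL]
    have e3 : ∀ i : Fin n, transition δ i (x i.castSucc) (x i.succ) =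
        ENNReal.ofReal (outgoing δ i (x i.castSucc) * incoming δ (i.val + 1) (x i.succ)) := by
      intro i
      rw [transition, indicator_of_mem, ENNReal.ofReal_mul (outgoing_nonneg _ _)]
      exact ⟨hlt i.castSucc_lt_succ, hgap i⟩
    simp_rw [chainDensity, e3]
    rw [e2, e1, ENNReal.ofReal_mul (by positivity), ENNReal.ofReal_mul (deriv_nonneg_apply _ _),
      ENNReal.ofReal_prod_of_nonneg]
    exact fun i _ => mul_nonneg (outgoing_nonneg _ _) (incoming_nonneg hC i.succ _)
  · have hL : u ∉ L δ := fun hL => hgap fun i => hx ▸ hL.2 i.castSucc i.succ rfl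
    push Not at hgap
    obtain ⟨i, hi⟩ := hgap
    rw [density, indicator_of_notMem hL, chainDensity, Finset.prod_eq_zero (Finset.mem_univ i)]
    · simp
    · rw [transition, indicator_of_notMem fun h => hi h.2]

lemma strictMono_of_chainDensity_ne_zero {f : ℝ → ℝ≥0∞} {x : Fin (n + 1) → ℝ}
    (hx : chainDensity f (transition δ) n x ≠ 0) : StrictMono x := by
  rw [Fin.strictMono_iff_lt_succ]
  intro i
  by_contra h
  apply hx
  rw [chainDensity, Finset.prod_eq_zero (Finset.mem_univ i), mul_zero]
  rw [transition, indicator_of_notMem fun h' => h h'.1]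

/-- The order statistics of `C_δ` have the law prescribed by `δ`. -/
lemma lintegral_density_mul_orderStat (hC : C ∈ copulasWith δ) (hN : ChargesGaps δ)
    (i : Fin (n + 1)) {g : ℝ → ℝ≥0∞} (hg : Measurable g) :
    ∫⁻ u, ENNReal.ofReal (density δ u) * g (orderStat u i) = ∫⁻ t, g t ∂(δ i).measure := by
  set f : ℕ → ℝ → ℝ≥0∞ := fun k t => ENNReal.ofReal (deriv (ext δ (k + 1)) t) with hf
  have hfm : ∀ k, Measurable (f k) := fun k => (measurable_deriv _).ennreal_ofReal
  have hfi : ∀ i : Fin (n + 1), f i = fun t => ENNReal.ofReal (deriv (δ i) t) := fun i => by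
    rw [← ext_succ (δ := δ) i]
  have hT : ∀ k < n, Measurable (Function.uncurry (transition δ k)) :=
    fun k hk => measurable_transition hC hk
  have hchain : Measurable (chainDensity (f 0) (transition δ) n) :=
    measurable_chainDensity (hfm 0) hT
  have hmap : ∀ k < n, ∀ᵐ s, ∫⁻ x, f k x * transition δ k x s = f (k + 1) s := by
    intro k hk
    have := lintegral_deriv_mul_transition hC hN ⟨k, hk⟩
    rw [← ext_succ, ← ext_succ] at this
    exact this
  have hone : ∀ k < n, ∀ᵐ x, f k x ≠ 0 → ∫⁻ s, transition δ k x s = 1 := by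
    intro k hk
    have := ae_deriv_eq_zero_of_notMem_right hC hN ⟨k, hk⟩
    filter_upwards [this] with x hx hne
    have hmem : x ∈ gapSet (δ (Fin.castSucc ⟨k, hk⟩)) (δ (Fin.succ ⟨k, hk⟩)) := by
      by_contra h
      apply hne
      have := hx h
      rw [← ext_succ] at this
      simp only [hf]
      rw [ENNReal.ofReal_eq_zero]
      exact this.le
    exact lintegral_transition hC (i := ⟨k, hk⟩) hmem
  have hd : ENNReal.ofReal (1 / ((n + 1) ! : ℝ)) * ((n + 1) ! : ℝ≥0∞) = 1 := by
    rw [← ENNReal.ofReal_natCast, ← ENNReal.ofReal_mul (by positivity), one_div,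
      inv_mul_cancel₀ (by positivity), ENNReal.ofReal_one]
  have hm : Measurable fun x : Fin (n + 1) → ℝ => chainDensity (f 0) (transition δ) n x * g (x i) :=
    hchain.mul (hg.comp (measurable_pi_apply i))
  calc ∫⁻ u, ENNReal.ofReal (density δ u) * g (orderStat u i)
      = ∫⁻ u, ENNReal.ofReal (1 / ((n + 1) ! : ℝ)) *
          (chainDensity (f 0) (transition δ) n (orderStat u) * g (orderStat u i)) := by
        apply lintegral_congr_ae
        filter_upwards [ae_ofReal_density hC] with u hu
        rw [hu, mul_assoc, show f 0 = _ from hfi 0]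
    _ = ∫⁻ x in {x | StrictMono x}, chainDensity (f 0) (transition δ) n x * g (x i) := by
        rw [lintegral_const_mul' _ _ ENNReal.ofReal_ne_top, lintegral_orderStat hm, ← mul_assoc,
          hd, one_mul]
    _ = ∫⁻ x, chainDensity (f 0) (transition δ) n x * g (x i) := by
        -- The restriction to increasing vectors is free: the transitions vanish unless the
        -- coordinates increase.
        rw [← lintegral_indicator measurableSet_strictMono]
        refine lintegral_congr fun x => ?_
        by_cases hx : StrictMono x
        · rw [indicator_of_mem hx]
        · rw [indicator_of_notMem hx,
            not_not.1 (mt strictMono_of_chainDensity_ne_zero hx), zero_mul]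
    _ = ∫⁻ t, f i t * g t := lintegral_chainDensity hfm hT hmap hone hg i
    _ = ∫⁻ t, g t ∂(δ i).measure := by rw [lintegral_measure hC i hg, hfi]

lemma density_comp_perm {d : ℕ} (δ : Fin d → StieltjesFunction ℝ) (u : Fin d → ℝ)
    (π : Equiv.Perm (Fin d)) : density δ (u ∘ π) = density δ u := by
  have h : u ∘ π ∈ L δ ↔ u ∈ L δ := by
    simp only [L, mem_ofPred_eq, orderStat_comp_perm]
    refine and_congr_left fun _ => ?_
    exact π.forall_congr_right (q := fun i => u i ∈ Icc (0 : ℝ) 1)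
  by_cases hu : u ∈ L δ
  · rw [density, indicator_of_mem hu, indicator_of_mem (h.2 hu), orderStat_comp_perm]
  · rw [density, indicator_of_notMem hu, indicator_of_notMem (mt h.1 hu)]

lemma isSymmetric_maxEntCopula (hC : C ∈ copulasWith δ) : IsSymmetric (maxEntCopula δ) := by
  intro π
  have hπ := measurePreserving_comp_perm π
  ext s hs
  rw [Measure.map_apply hπ.measurable hs, maxEntCopula, withDensity_apply _ (hπ.measurable hs),
    withDensity_apply _ hs]
  rw [← hπ.setLIntegral_comp_preimage hs (measurable_density hC).ennreal_ofReal]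
  simp_rw [density_comp_perm]

lemma map_orderStat_maxEntCopula (hC : C ∈ copulasWith δ) (hN : ChargesGaps δ) (i : Fin (n + 1)) :
    (maxEntCopula δ).map (fun u => orderStat u i) = (δ i).measure := by
  ext s hs
  have hm : Measurable (s.indicator (1 : ℝ → ℝ≥0∞)) := measurable_one.indicator hs
  rw [← lintegral_indicator_one hs, lintegral_map hm (by fun_prop), maxEntCopula,
    ← lintegral_indicator_one hs, ← lintegral_density_mul_orderStat hC hN i hm]
  exact lintegral_withDensity_eq_lintegral_mul _ (measurable_density hC).ennreal_ofReal
    (hm.comp (measurable_orderStat_apply i))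

lemma isProbabilityMeasure_maxEntCopula (hC : C ∈ copulasWith δ) (hN : ChargesGaps δ) :
    IsProbabilityMeasure (maxEntCopula δ) := by
  have := isProbabilityMeasure_measure hC 0
  have h := map_orderStat_maxEntCopula hC hN 0
  refine ⟨?_⟩
  rw [← measure_univ (μ := (δ 0).measure), ← h, Measure.map_apply (by fun_prop) .univ,
    preimage_univ]

/-- By symmetry all marginals coincide, and they sum to the laws of the order statistics, that is,
to `n + 1` times the uniform law. -/
lemma map_eval_maxEntCopula (hC : C ∈ copulasWith δ) (hN : ChargesGaps δ) (i : Fin (n + 1)) :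
    (maxEntCopula δ).map (fun u => u i) = volume.restrict (Icc (0 : ℝ) 1) := by
  ext s hs
  have hm : Measurable (s.indicator (1 : ℝ → ℝ≥0∞)) := measurable_one.indicator hs
  have hsym : ∀ j, (maxEntCopula δ).map (fun u => u j) s = (maxEntCopula δ).map (fun u => u i) s := by
    intro j
    conv_rhs => rw [← isSymmetric_maxEntCopula hC (Equiv.swap i j)]
    rw [Measure.map_map (by fun_prop) (measurePreserving_comp_perm _).measurable]
    simp [Function.comp_def]
  have hsum : ∑ j, (maxEntCopula δ).map (fun u => u j) s = ∑ j, (δ j).measure s := by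
    simp_rw [← map_orderStat_maxEntCopula hC hN, ← lintegral_indicator_one hs]
    have e1 : ∀ j : Fin (n + 1), ∫⁻ t, s.indicator 1 t ∂(maxEntCopula δ).map (fun u => u j) =
        ∫⁻ u, s.indicator 1 (u j) ∂maxEntCopula δ := fun j => lintegral_map hm (by fun_prop)
    have e2 : ∀ j : Fin (n + 1),
        ∫⁻ t, s.indicator 1 t ∂(maxEntCopula δ).map (fun u => orderStat u j) =
        ∫⁻ u, s.indicator 1 (orderStat u j) ∂maxEntCopula δ := fun j => lintegral_map hm (by fun_prop)
    simp_rw [e1, e2]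
    rw [← lintegral_finsetSum, ← lintegral_finsetSum]
    · simp_rw [sum_orderStat]
    · exact fun j _ => hm.comp (measurable_orderStat_apply j)
    · exact fun j _ => hm.comp (measurable_pi_apply j)
  have h3 : ∑ j, (δ j).measure s = ((n + 1 : ℕ) : ℝ≥0∞) * volume.restrict (Icc (0 : ℝ) 1) s := by
    rw [← Measure.finsetSum_apply, sum_measure hC]
    rfl
  simp_rw [hsym] at hsum
  rw [h3, Finset.sum_const, Finset.card_univ, Fintype.card_fin, nsmul_eq_mul] at hsum
  exact (ENNReal.mul_right_inj (by simp) (by finiteness)).1 hsum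

lemma maxEntCopula_mem (hC : C ∈ copulasWith δ) (hN : ChargesGaps δ) :
    maxEntCopula δ ∈ copulasWith δ := by
  refine ⟨⟨isProbabilityMeasure_maxEntCopula hC hN, map_eval_maxEntCopula hC hN⟩, fun i t => ?_⟩
  rw [eq_measureReal_Iic hC, ← map_orderStat_maxEntCopula hC hN,
    map_measureReal_apply (by fun_prop) measurableSet_Iic]
  rfl

lemma maxEntCopula_absolutelyContinuous {d : ℕ} (δ : Fin d → StieltjesFunction ℝ) :
    maxEntCopula δ ≪ volume :=
  withDensity_absolutelyContinuous _ _

end MaxEnt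

/-! ### The logarithm of `c_δ` under an arbitrary copula of the class. -/

section LogDensity

variable {n : ℕ} {δ : Fin (n + 1) → StieltjesFunction ℝ} {C : Measure (Fin (n + 1) → ℝ)}

/-- Under a copula with multidiagonal `δ`, the probability that `s` separates two consecutive
order statistics. -/
lemma measure_separate (hC : C ∈ copulasWith δ) (i : Fin n) (s : ℝ) :
    C {u | orderStat u i.castSucc ≤ s ∧ s < orderStat u i.succ} =
      ENNReal.ofReal (δ i.castSucc s - δ i.succ s) := by
  have := hC.1.isProbabilityMeasure
  have hm : ∀ j, MeasurableSet {u : Fin (n + 1) → ℝ | orderStat u j ≤ s} := fun j =>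
    measurable_orderStat_apply j measurableSet_Iic
  have hsub : {u : Fin (n + 1) → ℝ | orderStat u i.succ ≤ s} ⊆ {u | orderStat u i.castSucc ≤ s} :=
    fun u hu => (monotone_orderStat u i.castSucc_le_succ).trans hu
  have hset : {u : Fin (n + 1) → ℝ | orderStat u i.castSucc ≤ s ∧ s < orderStat u i.succ} =
      {u | orderStat u i.castSucc ≤ s} \ {u | orderStat u i.succ ≤ s} := by
    ext u; simp
  rw [hset, ← ofReal_measureReal (measure_ne_top _ _), measureReal_sdiff hsub (hm _), hC.2, hC.2]

/-- A point outside the gap set separates the two order statistics with probability zero. A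
countable dense subset of the complement suffices, since the interval is open. -/
lemma ae_Ioo_subset_gapSet (hC : C ∈ copulasWith δ) (i : Fin n) : ∀ᵐ u ∂C,
    Ioo (orderStat u i.castSucc) (orderStat u i.succ) ⊆ gapSet (δ i.castSucc) (δ i.succ) := by
  have hg := gapPair_succ hC i
  obtain ⟨D, hDs, hDc, hD⟩ := (TopologicalSpace.IsSeparable.of_separableSpace
    (gapSet (δ i.castSucc) (δ i.succ))ᶜ).exists_countable_dense_subset
  have h : ∀ᵐ u ∂C, ∀ r ∈ D, ¬ (orderStat u i.castSucc ≤ r ∧ r < orderStat u i.succ) := by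
    rw [ae_ball_iff hDc]
    intro r hr
    rw [ae_iff]
    simp only [not_not]
    rw [measure_separate hC, hg.eq_of_notMem (hDs hr), sub_self, ENNReal.ofReal_zero]
  filter_upwards [h] with u hu s hs
  by_contra hsO
  obtain ⟨r, hr, hrD⟩ := mem_closure_iff.1 (hD hsO) _ isOpen_Ioo hs
  exact hu r hrD ⟨hr.1.le, hr.2⟩

lemma ae_mem_Psi (hC : C ∈ copulasWith δ) (hN : ChargesGaps δ) :
    ∀ᵐ u ∂C, ∀ i : Fin (n + 1), orderStat u i ∈ Psi δ (i.val + 1) ∩ Psi δ (i.val + 2) := by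
  rw [ae_all_iff]
  intro i
  have h1 : ∀ᵐ t ∂(δ i).measure, t ∈ Psi δ (i.val + 1) := measure_compl_Psi hC hN i
  have h2 : ∀ᵐ t ∂(δ i).measure, t ∈ Psi δ (i.val + 2) := measure_compl_Psi_succ hC hN i
  exact ae_of_ae_measure hC i (h1.and h2)

lemma ae_mem_gapSet (hC : C ∈ copulasWith δ) (hN : ChargesGaps δ) :
    ∀ᵐ u ∂C, ∀ i : Fin n, orderStat u i.castSucc ∈ gapSet (δ i.castSucc) (δ i.succ) ∧
      orderStat u i.succ ∈ gapSet (δ i.castSucc) (δ i.succ) := by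
  filter_upwards [ae_mem_Psi hC hN] with u hu i
  have h1 := (hu i.castSucc).2
  have h2 := (hu i.succ).1
  simp only [Fin.val_castSucc, Fin.val_succ, add_assoc, Nat.reduceAdd, Psi_castSucc_succ] at h1 h2
  exact ⟨h1, h2⟩

lemma Icc_subset_of_Ioo_subset {O : Set ℝ} {x y : ℝ} (hx : x ∈ O) (hy : y ∈ O) (h : Ioo x y ⊆ O) :
    Icc x y ⊆ O := by
  intro z hz
  rcases hz.1.eq_or_lt with rfl | h1
  · exact hx
  rcases hz.2.eq_or_lt with rfl | h2
  · exact hy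
  exact h ⟨h1, h2⟩

/-- The increment between two consecutive order statistics of the primitive of the rate. -/
noncomputable def hazardIncrement (δ : Fin (n + 1) → StieltjesFunction ℝ) (i : Fin n)
    (u : Fin (n + 1) → ℝ) : ℝ :=
  (gapSet (δ i.castSucc) (δ i.succ)).indicator (cumHazard (δ i.castSucc) (δ i.succ))
      (orderStat u i.succ) -
    (gapSet (δ i.castSucc) (δ i.succ)).indicator (cumHazard (δ i.castSucc) (δ i.succ))
      (orderStat u i.castSucc)

lemma measurable_hazardIncrement (hC : C ∈ copulasWith δ) (i : Fin n) :
    Measurable (hazardIncrement δ i) := by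
  have hg := gapPair_succ hC i
  have := measurable_indicator_of_continuousOn hg.isOpen_gapSet hg.continuousOn_cumHazard
  exact (this.comp (measurable_orderStat_apply _)).sub (this.comp (measurable_orderStat_apply _))

/-- The half-open interval is chosen to match the separation event of `measure_separate`. -/
lemma ae_hazardIncrement (hC : C ∈ copulasWith δ) (hN : ChargesGaps δ) (i : Fin n) :
    ∀ᵐ u ∂C, 0 ≤ hazardIncrement δ i u ∧ ENNReal.ofReal (hazardIncrement δ i u) =
      ∫⁻ s in Ico (orderStat u i.castSucc) (orderStat u i.succ),
        ENNReal.ofReal (hazard (δ i.castSucc) (δ i.succ) s) := by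
  have hg := gapPair_succ hC i
  filter_upwards [ae_mem_gapSet hC hN, ae_Ioo_subset_gapSet hC i] with u hu hgap
  have hle := monotone_orderStat u i.castSucc_le_succ
  have hsub := Icc_subset_of_Ioo_subset (hu i).1 (hu i).2 hgap
  rw [hazardIncrement, indicator_of_mem (hu i).1, indicator_of_mem (hu i).2]
  refine ⟨sub_nonneg.2 (hg.cumHazard_le hsub hle), ?_⟩
  rw [← uIcc_of_le hle] at hsub
  rw [setLIntegral_congr Ico_ae_eq_Ioc, setLIntegral_Ioc_ofReal hle hg.hazard_nonneg
    (hg.intervalIntegrable_hazard hsub) (hg.cumHazard_sub hsub).symm]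

/-- By Tonelli the mean is the integral of the rate times the separation probability, hence the mass
that `δ i.succ` gives to the gap set. The dependence structure of `C` plays no role. -/
lemma lintegral_hazardIncrement (hC : C ∈ copulasWith δ) (hN : ChargesGaps δ) (i : Fin n) :
    ∫⁻ u, ENNReal.ofReal (hazardIncrement δ i u) ∂C = 1 := by
  have := hC.1.isProbabilityMeasure
  have hg := gapPair_succ hC i
  have hh : Measurable fun s => ENNReal.ofReal (hazard (δ i.castSucc) (δ i.succ) s) :=
    hg.measurable_hazard.ennreal_ofReal
  have hS : MeasurableSet {p : (Fin (n + 1) → ℝ) × ℝ |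
      orderStat p.1 i.castSucc ≤ p.2 ∧ p.2 < orderStat p.1 i.succ} :=
    (measurableSet_le (by fun_prop) measurable_snd).inter
      (measurableSet_lt measurable_snd (by fun_prop))
  have hm : Measurable fun p : (Fin (n + 1) → ℝ) × ℝ =>
      {p : (Fin (n + 1) → ℝ) × ℝ | orderStat p.1 i.castSucc ≤ p.2 ∧
        p.2 < orderStat p.1 i.succ}.indicator
        (fun p => ENNReal.ofReal (hazard (δ i.castSucc) (δ i.succ) p.2)) p :=
    (hh.comp measurable_snd).indicator hS
  have hO : MeasurableSet (gapSet (δ i.castSucc) (δ i.succ)) := hg.isOpen_gapSet.measurableSet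
  have hprob := isProbabilityMeasure_measure hC i.succ
  calc ∫⁻ u, ENNReal.ofReal (hazardIncrement δ i u) ∂C
      = ∫⁻ u, (∫⁻ s, {p : (Fin (n + 1) → ℝ) × ℝ | orderStat p.1 i.castSucc ≤ p.2 ∧
          p.2 < orderStat p.1 i.succ}.indicator
          (fun p => ENNReal.ofReal (hazard (δ i.castSucc) (δ i.succ) p.2)) (u, s)) ∂C := by
        apply lintegral_congr_ae
        filter_upwards [ae_hazardIncrement hC hN i] with u hu
        rw [hu.2, ← lintegral_indicator measurableSet_Ico]
        rfl
    _ = ∫⁻ s, ∫⁻ u, {p : (Fin (n + 1) → ℝ) × ℝ | orderStat p.1 i.castSucc ≤ p.2 ∧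
          p.2 < orderStat p.1 i.succ}.indicator
          (fun p => ENNReal.ofReal (hazard (δ i.castSucc) (δ i.succ) p.2)) (u, s) ∂C :=
        lintegral_lintegral_swap hm.aemeasurable
    _ = ∫⁻ s, ENNReal.ofReal (hazard (δ i.castSucc) (δ i.succ) s) *
          ENNReal.ofReal (δ i.castSucc s - δ i.succ s) := by
        refine lintegral_congr fun s => ?_
        rw [← measure_separate hC, ← lintegral_indicator_const]
        · rfl
        · exact measurable_prodMk_right hS
    _ = ∫⁻ s in gapSet (δ i.castSucc) (δ i.succ), ENNReal.ofReal (deriv (δ i.succ) s) := by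
        rw [← lintegral_indicator hO]
        refine lintegral_congr fun s => ?_
        by_cases hs : s ∈ gapSet (δ i.castSucc) (δ i.succ)
        · rw [indicator_of_mem hs, ← ENNReal.ofReal_mul (hg.hazard_nonneg s), hazard,
            div_mul_cancel₀ _ (sub_pos.2 hs).ne']
        · rw [indicator_of_notMem hs, hg.eq_of_notMem hs, sub_self, ENNReal.ofReal_zero, mul_zero]
    _ = 1 := by
        rw [← withDensity_apply _ hO, ← measure_eq_withDensity hC]
        exact (prob_compl_eq_zero_iff hO).1 (hN i.castSucc i.succ rfl)

lemma integrable_hazardIncrement (hC : C ∈ copulasWith δ) (hN : ChargesGaps δ) (i : Fin n) :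
    Integrable (hazardIncrement δ i) C := by
  refine ⟨(measurable_hazardIncrement hC i).aestronglyMeasurable, ?_⟩
  rw [hasFiniteIntegral_iff_ofReal, lintegral_hazardIncrement hC hN i]
  · simp
  · filter_upwards [ae_hazardIncrement hC hN i] with u hu using hu.1

lemma integral_hazardIncrement (hC : C ∈ copulasWith δ) (hN : ChargesGaps δ) (i : Fin n) :
    ∫ u, hazardIncrement δ i u ∂C = 1 := by
  rw [integral_eq_lintegral_of_nonneg_ae, lintegral_hazardIncrement hC hN i, ENNReal.toReal_one]
  · filter_upwards [ae_hazardIncrement hC hN i] with u hu using hu.1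
  · exact (measurable_hazardIncrement hC i).aestronglyMeasurable

lemma measurable_log_deriv (i : Fin (n + 1)) : Measurable fun t => Real.log (deriv (δ i) t) :=
  Real.measurable_log.comp (measurable_deriv _)

/-- Against Lebesgue measure the integrand is `x log x` at `x = δ_(k)'`, which is bounded because `0
≤ δ_(k)' ≤ d`, and it vanishes almost everywhere outside `[0, 1]`. -/
lemma integrable_log_deriv_measure (hC : C ∈ copulasWith δ) (i : Fin (n + 1)) :
    Integrable (fun t => Real.log (deriv (δ i) t)) (δ i).measure := by
  rw [measure_eq_withDensity hC i, integrable_withDensity_iff_integrable_smul'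
    (measurable_deriv _).ennreal_ofReal (.of_forall fun _ => ENNReal.ofReal_lt_top)]
  have hcomp : IsCompact (Icc (0 : ℝ) (n + 1 : ℕ)) := isCompact_Icc
  obtain ⟨M, hM⟩ := hcomp.exists_bound_of_continuousOn
    (Real.continuous_mul_log.continuousOn (s := Icc (0 : ℝ) (n + 1 : ℕ)))
  have hI : IntegrableOn (fun t => deriv (δ i) t * Real.log (deriv (δ i) t)) (Icc 0 1) := by
    refine IntegrableOn.of_bound (by simp) ?_ M (.of_forall fun t => ?_)
    · exact ((measurable_deriv _).mul (measurable_log_deriv i)).aestronglyMeasurable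
    · exact hM _ ⟨deriv_nonneg_apply i t, deriv_le hC i t⟩
  rw [← integrable_indicator_iff measurableSet_Icc] at hI
  refine hI.congr ?_
  filter_upwards [deriv_eq_zero_of_ae hC i (measure_compl_Icc hC i)] with t ht
  by_cases h : t ∈ Icc (0 : ℝ) 1
  · rw [indicator_of_mem h, ENNReal.toReal_ofReal (deriv_nonneg_apply i t), smul_eq_mul]
  · rw [indicator_of_notMem h, ht h]
    simp

lemma integrable_comp_orderStat (hC : C ∈ copulasWith δ) (i : Fin (n + 1)) {g : ℝ → ℝ}
    (hgm : Measurable g) (hg : Integrable g (δ i).measure) :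
    Integrable (fun u => g (orderStat u i)) C := by
  rw [measure_eq_map hC i] at hg
  exact (integrable_map_measure hgm.aestronglyMeasurable (by fun_prop)).1 hg

lemma integral_comp_orderStat (hC : C ∈ copulasWith δ) (i : Fin (n + 1)) {g : ℝ → ℝ}
    (hgm : Measurable g) : ∫ u, g (orderStat u i) ∂C = ∫ t, g t ∂(δ i).measure := by
  rw [measure_eq_map hC i, integral_map (by fun_prop) hgm.aestronglyMeasurable]

/-- The part of `log c_δ` that is integrable for every copula with multidiagonal `δ`. -/
noncomputable def logDensityRegular (δ : Fin (n + 1) → StieltjesFunction ℝ)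
    (u : Fin (n + 1) → ℝ) : ℝ :=
  -Real.log ((n + 1) ! : ℝ) + ∑ i : Fin (n + 1), Real.log (deriv (δ i) (orderStat u i)) -
    ∑ i : Fin n, hazardIncrement δ i u

/-- The part of `log c_δ` whose integral is `J δ`. -/
noncomputable def logDensityGap (δ : Fin (n + 1) → StieltjesFunction ℝ)
    (u : Fin (n + 1) → ℝ) : ℝ :=
  ∑ i : Fin n, -Real.log (δ i.castSucc (orderStat u i.succ) - δ i.succ (orderStat u i.succ))

lemma integrable_logDensityRegular (hC : C ∈ copulasWith δ) (hN : ChargesGaps δ) :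
    Integrable (logDensityRegular δ) C := by
  have := hC.1.isProbabilityMeasure
  refine ((integrable_const _).add (integrable_finsetSum _ fun i _ => ?_)).sub
    (integrable_finsetSum _ fun i _ => integrable_hazardIncrement hC hN i)
  exact integrable_comp_orderStat hC i (measurable_log_deriv i) (integrable_log_deriv_measure hC i)

lemma integral_logDensityRegular (hC : C ∈ copulasWith δ) (hN : ChargesGaps δ) :
    ∫ u, logDensityRegular δ u ∂C = -Real.log ((n + 1) ! : ℝ) +
      ∑ i, ∫ t, Real.log (deriv (δ i) t) ∂(δ i).measure - n := by
  have := hC.1.isProbabilityMeasure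
  have h1 : ∀ i : Fin (n + 1), Integrable (fun u => Real.log (deriv (δ i) (orderStat u i))) C :=
    fun i => integrable_comp_orderStat hC i (measurable_log_deriv i)
      (integrable_log_deriv_measure hC i)
  have h2 := integrable_hazardIncrement hC hN
  unfold logDensityRegular
  rw [integral_sub, integral_add (integrable_const _), integral_finsetSum _ fun i _ => h1 i,
    integral_finsetSum _ fun i _ => h2 i]
  · simp_rw [integral_hazardIncrement hC hN,
      fun i => integral_comp_orderStat hC i (measurable_log_deriv (δ := δ) i)]
    simp
  · exact integrable_finsetSum _ fun i _ => h1 i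
  · exact (integrable_const _).add (integrable_finsetSum _ fun i _ => h1 i)
  · exact integrable_finsetSum _ fun i _ => h2 i

/-- For every copula with multidiagonal `δ`, almost surely `c_δ` is positive and its logarithm is
the sum of the two parts. -/
lemma ae_log_density (hC : C ∈ copulasWith δ) (hN : ChargesGaps δ) :
    ∀ᵐ u ∂C, 0 < density δ u ∧
      Real.log (density δ u) = logDensityRegular δ u + logDensityGap δ u := by
  have hpt : ∀ i : Fin (n + 1), ∀ᵐ t, incoming δ 0 t = deriv (δ 0) t ∧
      (incoming δ n t = 0 ∨ outgoing δ n t = 1) ∧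
      ∀ j : Fin n, t ∈ gapSet (δ j.castSucc) (δ j.succ) → incoming δ (j.val + 1) t =
        hazard (δ j.castSucc) (δ j.succ) t *
          Real.exp (-cumHazard (δ j.castSucc) (δ j.succ) t) := fun i => by
    filter_upwards [ae_incoming_zero hC, ae_incoming_last hC,
      ae_all_iff.2 fun j => ae_incoming_succ hC j] with t h1 h2 h3 using ⟨h1, h2, h3⟩
  -- Null sets of the line may be discarded even if `C` is singular, since each order statistic has
  -- an absolutely continuous law.
  have hpt' := ae_all_iff.2 fun i : Fin (n + 1) =>
    ae_of_ae_measure hC i ((measure_absolutelyContinuous hC i).ae_le (hpt i))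
  have hpos := ae_all_iff.2 fun i : Fin (n + 1) => ae_of_ae_measure hC i (ae_deriv_pos hC i)
  filter_upwards [hpt', hpos, ae_mem_Psi hC hN, ae_mem_gapSet hC hN,
    ae_all_iff.2 fun i => ae_Ioo_subset_gapSet hC i] with u h1 h2 h3 h4 h5
  have hL : u ∈ L δ := by
    rw [mem_L_iff fun i => Psi_subset hC i.castSucc (h3 i).1]
    intro i
    rw [Psi_castSucc_succ]
    exact h5 i
  have hG : ∀ i : Fin n,
      0 < δ i.castSucc (orderStat u i.succ) - δ i.succ (orderStat u i.succ) :=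
    fun i => sub_pos.2 (h4 i).2
  have hfac : ∀ i : Fin n, outgoing δ i (orderStat u i.castSucc) *
      incoming δ (i.val + 1) (orderStat u i.succ) =
      Real.exp (-hazardIncrement δ i u) * (deriv (δ i.succ) (orderStat u i.succ) /
        (δ i.castSucc (orderStat u i.succ) - δ i.succ (orderStat u i.succ))) := by
    intro i
    rw [outgoing_castSucc (h4 i).1, (h1 i.succ).2.2 i (h4 i).2, hazard, hazardIncrement,
      indicator_of_mem (h4 i).1, indicator_of_mem (h4 i).2, neg_sub, Real.exp_sub, Real.exp_neg]
    ring
  have hd : density δ u = 1 / ((n + 1) ! : ℝ) * (deriv (δ 0) (orderStat u 0) *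
      ∏ i : Fin n, (Real.exp (-hazardIncrement δ i u) * (deriv (δ i.succ) (orderStat u i.succ) /
        (δ i.castSucc (orderStat u i.succ) - δ i.succ (orderStat u i.succ))))) := by
    rw [density, indicator_of_mem hL, prod_a_eq (h1 0).1 (h1 (Fin.last n)).2.1]
    simp_rw [hfac]
  have hfpos : ∀ i : Fin n, 0 < Real.exp (-hazardIncrement δ i u) *
      (deriv (δ i.succ) (orderStat u i.succ) /
        (δ i.castSucc (orderStat u i.succ) - δ i.succ (orderStat u i.succ))) :=
    fun i => mul_pos (Real.exp_pos _) (div_pos (h2 i.succ) (hG i))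
  have hprod := Finset.prod_pos fun i (_ : i ∈ Finset.univ) => hfpos i
  have hfact : 0 < 1 / ((n + 1) ! : ℝ) := by positivity
  refine ⟨hd ▸ mul_pos hfact (mul_pos (h2 0) hprod), ?_⟩
  rw [hd, Real.log_mul hfact.ne' (mul_pos (h2 0) hprod).ne', Real.log_mul (h2 0).ne' hprod.ne',
    Real.log_prod fun i _ => (hfpos i).ne', logDensityRegular, logDensityGap, Fin.sum_univ_succ,
    one_div, Real.log_inv]
  have hlog : ∀ i : Fin n, Real.log (Real.exp (-hazardIncrement δ i u) *
      (deriv (δ i.succ) (orderStat u i.succ) /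
        (δ i.castSucc (orderStat u i.succ) - δ i.succ (orderStat u i.succ)))) =
      Real.log (deriv (δ i.succ) (orderStat u i.succ)) - hazardIncrement δ i u +
      -Real.log (δ i.castSucc (orderStat u i.succ) - δ i.succ (orderStat u i.succ)) := by
    intro i
    rw [Real.log_mul (Real.exp_pos _).ne' (div_pos (h2 i.succ) (hG i)).ne', Real.log_exp,
      Real.log_div (h2 i.succ).ne' (hG i).ne']
    ring
  simp_rw [hlog]
  rw [Finset.sum_add_distrib, Finset.sum_sub_distrib]
  ring

end LogDensity

/-! ### Gibbs' pointwise inequality and integrability of the entropy. -/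

section Entropy

/-- For `c > 0` this is `log r ≤ r - 1` at `r = q / c`, strict unless `r = 1`. -/
lemma negMulLog_add_mul_log_le {c q : ℝ} (hc : 0 ≤ c) (hq : 0 ≤ q) (hcq : 0 < c → 0 < q) :
    Real.negMulLog c + c * Real.log q ≤ q - c ∧
      (Real.negMulLog c + c * Real.log q = q - c → c = q) := by
  rcases hc.eq_or_lt with rfl | hc
  · simp [hq]
  have hq := hcq hc
  have hr : 0 < q / c := div_pos hq hc
  have he : Real.negMulLog c + c * Real.log q = c * Real.log (q / c) := by
    rw [Real.log_div hq.ne' hc.ne', Real.negMulLog]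
    ring
  have he2 : q - c = c * (q / c - 1) := by field_simp
  rw [he, he2]
  refine ⟨mul_le_mul_of_nonneg_left (Real.log_le_sub_one_of_pos hr) hc.le, fun h => ?_⟩
  by_contra hne
  have h1 : q / c ≠ 1 := fun h => hne ((div_eq_one_iff_eq hc.ne').1 h).symm
  exact (Real.log_lt_sub_one_of_pos hr h1).ne (mul_left_cancel₀ hc.ne' h)

variable {d : ℕ} {C : Measure (Fin d → ℝ)}

/-- The integrand in the entropy of a measure on `ℝ^d`. -/
noncomputable def entropyIntegrand (C : Measure (Fin d → ℝ)) (u : Fin d → ℝ) : ℝ :=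
  Real.negMulLog (C.rnDeriv volume u).toReal

lemma measurable_entropyIntegrand : Measurable (entropyIntegrand C) :=
  Real.continuous_negMulLog.measurable.comp (Measure.measurable_rnDeriv _ _).ennreal_toReal

/-- The density lives on the unit cube, where `-x log x ≤ 1 - x ≤ 1`. Hence the extended difference
defining `entropy` is never `∞ - ∞` for a copula, and non-integrability can only mean `-∞`. -/
lemma lintegral_entropyIntegrand_ne_top (hC : IsCopula C) (hac : C ≪ volume) :
    ∫⁻ u, ENNReal.ofReal (entropyIntegrand C u) ≠ ⊤ := by
  have := hC.isProbabilityMeasure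
  set I : Set (Fin d → ℝ) := Icc 0 1
  have hI : ∀ᵐ u ∂C, u ∈ I := by
    have h : ∀ᵐ u ∂C, ∀ i, u i ∈ Icc (0 : ℝ) 1 := by
      rw [ae_all_iff]
      intro i
      apply ae_of_ae_map (μ := C) (f := fun u => u i) (p := fun t => t ∈ Icc (0 : ℝ) 1)
        (measurable_pi_apply i).aemeasurable
      rw [hC.map_eval i]
      exact ae_restrict_mem measurableSet_Icc
    filter_upwards [h] with u hu
    exact ⟨fun i => (hu i).1, fun i => (hu i).2⟩
  have h0 : ∀ᵐ u, u ∉ I → C.rnDeriv volume u = 0 := by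
    rw [← Measure.withDensity_rnDeriv_eq C volume hac,
      ae_withDensity_iff (Measure.measurable_rnDeriv _ _)] at hI
    filter_upwards [hI] with u hu hu'
    by_contra h
    exact hu' (hu h)
  have hle : ∫⁻ u, ENNReal.ofReal (entropyIntegrand C u) ≤ ∫⁻ u, I.indicator 1 u := by
    apply lintegral_mono_ae
    filter_upwards [h0] with u hu
    by_cases h : u ∈ I
    · rw [indicator_of_mem h, Pi.one_apply, ENNReal.ofReal_le_one]
      have := Real.negMulLog_le_one_sub_self
        (ENNReal.toReal_nonneg (a := C.rnDeriv volume u))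
      exact this.trans (sub_le_self _ ENNReal.toReal_nonneg)
    · rw [entropyIntegrand, hu h]
      simp
  refine (hle.trans_lt ?_).ne
  rw [lintegral_indicator_one measurableSet_Icc]
  exact isCompact_Icc.measure_lt_top

lemma entropy_of_not_integrable (h : ¬ Integrable (entropyIntegrand C)) (hC : IsCopula C) :
    entropy C = ⊥ := by
  rw [entropy]
  split_ifs with hac
  · have hp := lintegral_entropyIntegrand_ne_top hC hac
    have hn : ∫⁻ u, ENNReal.ofReal (-entropyIntegrand C u) = ⊤ := by
      by_contra hn
      apply h
      refine ⟨measurable_entropyIntegrand.aestronglyMeasurable, ?_⟩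
      rw [hasFiniteIntegral_iff_norm]
      have : ∀ u, ENNReal.ofReal ‖entropyIntegrand C u‖ =
          ENNReal.ofReal (entropyIntegrand C u) + ENNReal.ofReal (-entropyIntegrand C u) := by
        intro u
        rcases le_total 0 (entropyIntegrand C u) with h | h
        · rw [Real.norm_of_nonneg h, ENNReal.ofReal_of_nonpos (neg_nonpos.2 h), add_zero]
        · rw [Real.norm_of_nonpos h, ENNReal.ofReal_of_nonpos h, zero_add]
      simp_rw [this]
      rw [lintegral_add_left measurable_entropyIntegrand.ennreal_ofReal]
      exact ENNReal.add_lt_top.2 ⟨hp.lt_top, lt_top_iff_ne_top.2 hn⟩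
    unfold entropyIntegrand at hn
    rw [hn, EReal.coe_ennreal_top, EReal.sub_top]
  · rfl

lemma entropy_of_integrable (h : Integrable (entropyIntegrand C)) (hac : C ≪ volume) :
    entropy C = ((∫ u, entropyIntegrand C u : ℝ) : EReal) := by
  have hp : ∫⁻ u, ENNReal.ofReal (entropyIntegrand C u) ≠ ⊤ := h.lintegral_lt_top.ne
  have hn : ∫⁻ u, ENNReal.ofReal (-entropyIntegrand C u) ≠ ⊤ := h.neg.lintegral_lt_top.ne
  rw [entropy, if_pos hac, integral_eq_lintegral_pos_part_sub_lintegral_neg_part h, EReal.coe_sub,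
    EReal.coe_ennreal_toReal hp, EReal.coe_ennreal_toReal hn]
  rfl

end Entropy

/-! ### The dichotomy on `J δ` and the maximiser. -/

section Maximum

variable {n : ℕ} {δ : Fin (n + 1) → StieltjesFunction ℝ} {C : Measure (Fin (n + 1) → ℝ)}

lemma measurable_absLog : Measurable absLog := by
  classical
  unfold absLog
  refine Measurable.ite (measurableSet_eq_fun measurable_id measurable_const) measurable_const ?_
  exact (measurable_norm.comp Real.measurable_log).ennreal_ofReal

lemma J_eq (δ : Fin (n + 1) → StieltjesFunction ℝ) :
    J δ = ∑ i : Fin n, ∫⁻ t, absLog (δ i.castSucc t - δ i.succ t) ∂(δ i.succ).measure := by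
  rw [J, Finset.sum_filter, Fin.sum_univ_succ]
  simp only [Fin.val_zero, lt_self_iff_false, if_false, zero_add, Fin.val_succ, Nat.zero_lt_succ,
    if_true]
  refine Finset.sum_congr rfl fun i _ => lintegral_congr fun t => ?_
  rw [← ext_succ (δ := δ) i.castSucc, ← ext_succ (δ := δ) i.succ]
  rfl

lemma measurable_gap (i : Fin n) : Measurable fun t => δ i.castSucc t - δ i.succ t :=
  (δ i.castSucc).mono.measurable.sub (δ i.succ).mono.measurable

/-- `Real.log 0 = 0` conflicts with `|log 0| = ∞`, but by `ChargesGaps` the zeros of the gap are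
null. -/
lemma ae_absLog_gap (hN : ChargesGaps δ) (i : Fin n) : ∀ᵐ t ∂(δ i.succ).measure,
    absLog (δ i.castSucc t - δ i.succ t) =
      ENNReal.ofReal ‖-Real.log (δ i.castSucc t - δ i.succ t)‖ := by
  have h : ∀ᵐ t ∂(δ i.succ).measure, t ∈ gapSet (δ i.castSucc) (δ i.succ) :=
    hN i.castSucc i.succ rfl
  filter_upwards [h] with t ht
  rw [absLog, if_neg (sub_pos.2 ht).ne', norm_neg, Real.norm_eq_abs]

lemma log_gap_nonneg (hC : C ∈ copulasWith δ) (i : Fin n) (t : ℝ) :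
    0 ≤ -Real.log (δ i.castSucc t - δ i.succ t) := by
  have h0 := (gapPair_succ hC i).le t
  have h1 := (mem_Icc_apply hC i.castSucc t).2
  have h2 := (mem_Icc_apply hC i.succ t).1
  exact neg_nonneg.2 (Real.log_nonpos (by linarith) (by linarith))

lemma logDensityGap_nonneg (hC : C ∈ copulasWith δ) (u : Fin (n + 1) → ℝ) :
    0 ≤ logDensityGap δ u :=
  Finset.sum_nonneg fun i _ => log_gap_nonneg hC i _

lemma measurable_log_gap (i : Fin n) :
    Measurable fun t => -Real.log (δ i.castSucc t - δ i.succ t) :=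
  (Real.measurable_log.comp (measurable_gap i)).neg

lemma measurable_logDensityGap : Measurable (logDensityGap δ) :=
  Finset.measurable_sum _ fun i _ => (measurable_log_gap i).comp (measurable_orderStat_apply i.succ)

lemma lintegral_logDensityGap (hC : C ∈ copulasWith δ) (hN : ChargesGaps δ) :
    ∫⁻ u, ENNReal.ofReal (logDensityGap δ u) ∂C = J δ := by
  unfold logDensityGap
  simp_rw [fun u : Fin (n + 1) → ℝ => ENNReal.ofReal_sum_of_nonneg (s := Finset.univ)
    fun (i : Fin n) _ => log_gap_nonneg hC i (orderStat u i.succ)]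
  rw [J_eq, lintegral_finsetSum]
  · refine Finset.sum_congr rfl fun i _ => ?_
    rw [lintegral_congr_ae (ae_absLog_gap hN i), measure_eq_map hC i.succ, lintegral_map]
    · refine lintegral_congr fun u => ?_
      rw [Real.norm_of_nonneg (log_gap_nonneg hC i _)]
    · exact (measurable_log_gap i).norm.ennreal_ofReal
    · fun_prop
  · exact fun i _ => ((measurable_log_gap i).comp
      (measurable_orderStat_apply i.succ)).ennreal_ofReal

/-- The integrand of `J` is infinite where the gap is zero, so that set must be null. -/
lemma chargesGaps_of_J_lt_top (hC : C ∈ copulasWith δ) (hJ : J δ < ⊤) : ChargesGaps δ := by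
  intro i j hij
  obtain ⟨k, rfl, rfl⟩ : ∃ k : Fin n, k.castSucc = i ∧ k.succ = j :=
    ⟨⟨i, by lia⟩, rfl, Fin.ext hij⟩
  rw [J_eq, ENNReal.sum_lt_top] at hJ
  have h := ae_lt_top (measurable_absLog.comp (measurable_gap k)) (hJ k (Finset.mem_univ k)).ne
  refine measure_mono_null (fun t ht => ?_) h
  simp [(gapPair_succ hC k).eq_of_notMem ht, absLog]

/-- Almost surely the two order statistics differ and the open interval between them lies in `O`. If
the upper one were outside `O`, it would be isolated from the left in the complement; such points
are countable and an atomless law misses them. -/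
lemma chargesGaps_of_absolutelyContinuous (hC : C ∈ copulasWith δ) (hac : C ≪ volume) :
    ChargesGaps δ := by
  intro i j hij
  obtain ⟨k, rfl, rfl⟩ : ∃ k : Fin n, k.castSucc = i ∧ k.succ = j :=
    ⟨⟨i, by lia⟩, rfl, Fin.ext hij⟩
  set O := gapSet (δ k.castSucc) (δ k.succ) with hO
  have hOo : IsOpen O := (gapPair_succ hC k).isOpen_gapSet
  have := nullSingletonClass_measure hC k.succ
  set S : Set ℝ := {x | x ∈ Oᶜ ∧ 𝓝[Oᶜ ∩ Iio x] x = ⊥}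
  have hS : S.Countable := countable_setOfPred_isolated_left_within
  have hS0 : ∀ᵐ t ∂(δ k.succ).measure, t ∉ S := hS.ae_notMem _
  have hCO : C {u | orderStat u k.succ ∈ Oᶜ} = 0 := by
    have hae : ∀ᵐ u ∂C, ¬ orderStat u k.succ ∈ Oᶜ := by
      filter_upwards [ae_Ioo_subset_gapSet hC k, hac.ae_le ae_injective,
        ae_of_ae_measure hC k.succ hS0] with u h1 h2 h3 h4
      refine h3 ⟨h4, ?_⟩
      have hlt : orderStat u k.castSucc < orderStat u k.succ :=
        strictMono_orderStat h2 k.castSucc_lt_succ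
      rw [← empty_mem_iff_bot]
      have hmem := inter_mem (mem_nhdsWithin_of_mem_nhds (t := Oᶜ ∩ Iio (orderStat u k.succ))
        (Ioi_mem_nhds hlt)) self_mem_nhdsWithin
      refine mem_of_superset hmem ?_
      rintro z ⟨hz1, hz2, hz3⟩
      exact hz2 (h1 ⟨hz1, hz3⟩)
    simpa [ae_iff] using hae
  rw [measure_eq_map hC, Measure.map_apply (by fun_prop) hOo.measurableSet.compl]
  exact hCO

/-- The logarithm of `c_δ` at almost every point charged by `C`. -/
lemma ae_log_density_volume (hC : C ∈ copulasWith δ) (hN : ChargesGaps δ) (hac : C ≪ volume) :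
    ∀ᵐ u, 0 < (C.rnDeriv volume u).toReal → 0 < density δ u ∧
      Real.log (density δ u) = logDensityRegular δ u + logDensityGap δ u := by
  have := hC.1.isProbabilityMeasure
  have h := ae_log_density hC hN
  rw [← Measure.withDensity_rnDeriv_eq C volume hac,
    ae_withDensity_iff (Measure.measurable_rnDeriv _ _)] at h
  filter_upwards [h] with u hu hpos
  exact hu (ENNReal.toReal_pos_iff.1 hpos).1.ne'

/-- The decomposition of `log c_δ` is known only where `C` has positive density; elsewhere both
products are zero. -/
lemma ae_gibbs (hC : C ∈ copulasWith δ) (hN : ChargesGaps δ) (hac : C ≪ volume) :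
    ∀ᵐ u, entropyIntegrand C u + (C.rnDeriv volume u).toReal *
        (logDensityRegular δ u + logDensityGap δ u) ≤
        density δ u - (C.rnDeriv volume u).toReal ∧
      (entropyIntegrand C u + (C.rnDeriv volume u).toReal *
        (logDensityRegular δ u + logDensityGap δ u) =
        density δ u - (C.rnDeriv volume u).toReal →
        (C.rnDeriv volume u).toReal = density δ u) := by
  filter_upwards [ae_log_density_volume hC hN hac] with u hu
  have hmul : (C.rnDeriv volume u).toReal * (logDensityRegular δ u + logDensityGap δ u) =
      (C.rnDeriv volume u).toReal * Real.log (density δ u) := by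
    rcases ENNReal.toReal_nonneg.eq_or_lt with h | h
    · rw [← h, zero_mul, zero_mul]
    · rw [(hu h).2]
  rw [hmul]
  exact negMulLog_add_mul_log_le ENNReal.toReal_nonneg (density_nonneg hC u) fun h => (hu h).1

lemma integrable_density (hC : C ∈ copulasWith δ) (hN : ChargesGaps δ) :
    Integrable (density δ) ∧ ∫ u, density δ u = 1 := by
  have h1 : ∫⁻ u, ENNReal.ofReal (density δ u) = 1 := by
    have := (isProbabilityMeasure_maxEntCopula hC hN).measure_univ
    rwa [maxEntCopula, withDensity_apply _ .univ, Measure.restrict_univ] at this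
  have hm := (measurable_density hC).aestronglyMeasurable (μ := volume)
  have hnn := ae_of_all volume (density_nonneg hC)
  refine ⟨⟨hm, ?_⟩, ?_⟩
  · rw [hasFiniteIntegral_iff_ofReal hnn, h1]
    simp
  · rw [integral_eq_lintegral_of_nonneg_ae hnn hm, h1, ENNReal.toReal_one]

lemma rnDeriv_maxEntCopula (hC : C ∈ copulasWith δ) :
    ∀ᵐ u, ((maxEntCopula δ).rnDeriv volume u).toReal = density δ u := by
  filter_upwards [Measure.rnDeriv_withDensity (volume : Measure (Fin (n + 1) → ℝ))
    (measurable_density hC).ennreal_ofReal] with u hu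
  rw [maxEntCopula, hu, ENNReal.toReal_ofReal (density_nonneg hC u)]

/-- A copula of finite entropy forces `J δ` to be finite. -/
lemma J_lt_top_of_integrable (hC : C ∈ copulasWith δ) (hac : C ≪ volume)
    (hi : Integrable (entropyIntegrand C)) : J δ < ⊤ := by
  have := hC.1.isProbabilityMeasure
  have hN := chargesGaps_of_absolutelyContinuous hC hac
  have hc : Integrable fun u => (C.rnDeriv volume u).toReal := Measure.integrable_toReal_rnDeriv
  have hr : Integrable fun u => (C.rnDeriv volume u).toReal * logDensityRegular δ u :=
    (integrable_rnDeriv_smul_iff hac).2 (integrable_logDensityRegular hC hN)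
  -- This majorises the density of `C` times `logDensityGap`, by Gibbs' inequality. That `c_δ` is
  -- integrable rests on `ChargesGaps` alone, so there is no circularity.
  have hb := (((integrable_density hC hN).1.sub hc).sub hi).sub hr
  rw [← lintegral_logDensityGap hC hN, ← lintegral_rnDeriv_mul hac
    measurable_logDensityGap.ennreal_ofReal.aemeasurable]
  refine lt_of_le_of_lt (lintegral_mono_ae ?_) hb.lintegral_lt_top
  filter_upwards [ae_gibbs hC hN hac, Measure.rnDeriv_lt_top C volume] with u hu hlt
  rw [← ENNReal.ofReal_toReal hlt.ne, ← ENNReal.ofReal_mul ENNReal.toReal_nonneg]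
  apply ENNReal.ofReal_le_ofReal
  simp only [Pi.sub_apply]
  linarith [hu.1, mul_add (C.rnDeriv volume u).toReal (logDensityRegular δ u) (logDensityGap δ u)]

/-- The integral of `log c_δ` against any copula with multidiagonal `δ`. -/
noncomputable def crossEntropy (δ : Fin (n + 1) → StieltjesFunction ℝ) : ℝ :=
  -Real.log ((n + 1) ! : ℝ) + ∑ i, ∫ t, Real.log (deriv (δ i) t) ∂(δ i).measure - n + (J δ).toReal

lemma integrable_logDensity (hC : C ∈ copulasWith δ) (hJ : J δ < ⊤) :
    Integrable (fun u => logDensityRegular δ u + logDensityGap δ u) C ∧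
      ∫ u, (logDensityRegular δ u + logDensityGap δ u) ∂C = crossEntropy δ := by
  have hN := chargesGaps_of_J_lt_top hC hJ
  have h1 := integrable_logDensityRegular hC hN
  have hnn := ae_of_all C (logDensityGap_nonneg hC)
  have hm : AEStronglyMeasurable (logDensityGap δ) C :=
    measurable_logDensityGap.aestronglyMeasurable
  have h2 : Integrable (logDensityGap δ) C := by
    refine ⟨hm, ?_⟩
    rw [hasFiniteIntegral_iff_ofReal hnn, lintegral_logDensityGap hC hN]
    exact hJ
  refine ⟨h1.add h2, ?_⟩
  rw [integral_add h1 h2, integral_logDensityRegular hC hN,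
    integral_eq_lintegral_of_nonneg_ae hnn hm, lintegral_logDensityGap hC hN, crossEntropy]

/-- Gibbs' inequality for a copula with multidiagonal `δ` and `C_δ`, with its equality case. -/
lemma integral_entropyIntegrand_le (hC : C ∈ copulasWith δ) (hJ : J δ < ⊤) (hac : C ≪ volume)
    (hi : Integrable (entropyIntegrand C)) :
    ∫ u, entropyIntegrand C u ≤ -crossEntropy δ ∧
      (∫ u, entropyIntegrand C u = -crossEntropy δ → C = maxEntCopula δ) := by
  have := hC.1.isProbabilityMeasure
  have hN := chargesGaps_of_J_lt_top hC hJ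
  have hc : Integrable fun u => (C.rnDeriv volume u).toReal := Measure.integrable_toReal_rnDeriv
  have hc1 : ∫ u, (C.rnDeriv volume u).toReal = 1 := by
    rw [Measure.integral_toReal_rnDeriv hac, probReal_univ]
  obtain ⟨hl, hl1⟩ := integrable_logDensity hC hJ
  obtain ⟨hq, hq1⟩ := integrable_density hC hN
  have hcl : Integrable fun u => (C.rnDeriv volume u).toReal *
      (logDensityRegular δ u + logDensityGap δ u) := (integrable_rnDeriv_smul_iff hac).2 hl
  have hcl1 : ∫ u, (C.rnDeriv volume u).toReal * (logDensityRegular δ u + logDensityGap δ u) =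
      crossEntropy δ := (integral_rnDeriv_smul hac).trans hl1
  have hg := ae_gibbs hC hN hac
  have hnn : 0 ≤ᵐ[volume] fun u => (density δ u - (C.rnDeriv volume u).toReal) -
      (entropyIntegrand C u + (C.rnDeriv volume u).toReal *
        (logDensityRegular δ u + logDensityGap δ u)) := by
    filter_upwards [hg] with u hu using sub_nonneg.2 hu.1
  have hqc : Integrable fun u => density δ u - (C.rnDeriv volume u).toReal := hq.sub hc
  have hil : Integrable fun u => entropyIntegrand C u + (C.rnDeriv volume u).toReal *
      (logDensityRegular δ u + logDensityGap δ u) := hi.add hcl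
  have hval : ∫ u, ((density δ u - (C.rnDeriv volume u).toReal) -
      (entropyIntegrand C u + (C.rnDeriv volume u).toReal *
        (logDensityRegular δ u + logDensityGap δ u))) =
      -(∫ u, entropyIntegrand C u) - crossEntropy δ := by
    rw [integral_sub hqc hil, integral_sub hq hc, integral_add hi hcl, hq1, hc1,
      hcl1]
    ring
  have h0 := integral_nonneg_of_ae hnn
  rw [hval] at h0
  refine ⟨by linarith, fun heq => ?_⟩
  -- Equality makes the non-negative Gibbs deficit integrate to zero, so it vanishes almost
  -- everywhere and the pointwise equality case identifies the densities.
  rw [heq, neg_neg, sub_self, integral_eq_zero_iff_of_nonneg_ae hnn (hqc.sub hil)] at hval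
  rw [← Measure.withDensity_rnDeriv_eq C volume hac, maxEntCopula]
  apply withDensity_congr_ae
  filter_upwards [hval, hg, Measure.rnDeriv_lt_top C volume] with u h1 h2 h3
  rw [← h2.2 (sub_eq_zero.1 h1).symm, ENNReal.ofReal_toReal h3.ne]

/-- `C_δ` itself belongs to the class, so the integral of `log c_δ` against it is the common value
`crossEntropy δ`, which is minus its own entropy. -/
lemma integral_entropyIntegrand_maxEntCopula (hC : C ∈ copulasWith δ) (hJ : J δ < ⊤) :
    Integrable (entropyIntegrand (maxEntCopula δ)) ∧
      ∫ u, entropyIntegrand (maxEntCopula δ) u = -crossEntropy δ := by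
  have hN := chargesGaps_of_J_lt_top hC hJ
  have hQ := maxEntCopula_mem hC hN
  have hac := maxEntCopula_absolutelyContinuous δ
  have := hQ.1.isProbabilityMeasure
  obtain ⟨hl, hl1⟩ := integrable_logDensity hQ hJ
  have he : (fun u => ((maxEntCopula δ).rnDeriv volume u).toReal *
      (logDensityRegular δ u + logDensityGap δ u)) =ᵐ[volume]
      fun u => -entropyIntegrand (maxEntCopula δ) u := by
    filter_upwards [ae_log_density_volume hQ hN hac, rnDeriv_maxEntCopula hC] with u h1 h2
    rw [entropyIntegrand, Real.negMulLog, neg_mul, neg_neg]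
    rcases (ENNReal.toReal_nonneg (a := (maxEntCopula δ).rnDeriv volume u)).eq_or_lt with h | h
    · rw [← h, zero_mul, zero_mul]
    · rw [← (h1 h).2, h2]
  have hcl : Integrable fun u => ((maxEntCopula δ).rnDeriv volume u).toReal *
      (logDensityRegular δ u + logDensityGap δ u) := (integrable_rnDeriv_smul_iff hac).2 hl
  have hcl1 : ∫ u, ((maxEntCopula δ).rnDeriv volume u).toReal *
      (logDensityRegular δ u + logDensityGap δ u) =
      crossEntropy δ := (integral_rnDeriv_smul hac).trans hl1
  refine ⟨?_, ?_⟩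
  · simpa using (hcl.congr he).neg
  · rw [← hcl1, integral_congr_ae he, integral_neg, neg_neg]

lemma entropy_maxEntCopula (hC : C ∈ copulasWith δ) (hJ : J δ < ⊤) :
    entropy (maxEntCopula δ) = ((-crossEntropy δ : ℝ) : EReal) := by
  obtain ⟨h1, h2⟩ := integral_entropyIntegrand_maxEntCopula hC hJ
  rw [entropy_of_integrable h1 (maxEntCopula_absolutelyContinuous δ), h2]

lemma entropy_eq_bot_of_J_eq_top (hC : C ∈ copulasWith δ) (hJ : J δ = ⊤) : entropy C = ⊥ := by
  by_cases hac : C ≪ volume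
  · refine entropy_of_not_integrable (fun hi => ?_) hC.1
    exact (J_lt_top_of_integrable hC hac hi).ne hJ
  · rw [entropy, if_neg hac]

lemma entropy_le (hC : C ∈ copulasWith δ) (hJ : J δ < ⊤) :
    entropy C ≤ ((-crossEntropy δ : ℝ) : EReal) ∧
      (entropy C = ((-crossEntropy δ : ℝ) : EReal) → C = maxEntCopula δ) := by
  have hbot : entropy C = ⊥ → entropy C ≤ ((-crossEntropy δ : ℝ) : EReal) ∧
      (entropy C = ((-crossEntropy δ : ℝ) : EReal) → C = maxEntCopula δ) := by
    intro h
    rw [h]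
    exact ⟨bot_le, fun h' => absurd h' (EReal.bot_ne_coe _)⟩
  by_cases hac : C ≪ volume
  swap
  · exact hbot (by rw [entropy, if_neg hac])
  by_cases hi : Integrable (entropyIntegrand C)
  swap
  · exact hbot (entropy_of_not_integrable hi hC.1)
  obtain ⟨h1, h2⟩ := integral_entropyIntegrand_le hC hJ hac hi
  rw [entropy_of_integrable hi hac]
  exact ⟨EReal.coe_le_coe_iff.2 h1, fun h => h2 (EReal.coe_eq_coe_iff.1 h)⟩

end Maximum

end MultidiagCopula

theorem mainTheorem2 (d : ℕ) (hd : 1 ≤ d) (δ : Fin d → StieltjesFunction ℝ)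
    (hδ : δ ∈ MultidiagCopula.multidiagonals d) :
    (MultidiagCopula.J δ = ⊤ →
      IsGreatest (MultidiagCopula.entropy '' MultidiagCopula.copulasWith δ) ⊥) ∧
    (MultidiagCopula.J δ < ⊤ →
      δ ∈ MultidiagCopula.multidiagonalsAC d ∧
      (∀ u, 0 ≤ MultidiagCopula.density δ u) ∧
      MultidiagCopula.maxEntCopula δ ∈ MultidiagCopula.copulasWith δ ∧
      MultidiagCopula.maxEntCopula δ ≪ volume ∧
      MultidiagCopula.IsSymmetric (MultidiagCopula.maxEntCopula δ) ∧
      ⊥ < MultidiagCopula.entropy (MultidiagCopula.maxEntCopula δ) ∧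
      IsGreatest (MultidiagCopula.entropy '' MultidiagCopula.copulasWith δ)
        (MultidiagCopula.entropy (MultidiagCopula.maxEntCopula δ)) ∧
      ∀ C ∈ MultidiagCopula.copulasWith δ,
        MultidiagCopula.entropy C = MultidiagCopula.entropy (MultidiagCopula.maxEntCopula δ) →
          C = MultidiagCopula.maxEntCopula δ) := by
  obtain ⟨n, rfl⟩ : ∃ n, d = n + 1 := ⟨d - 1, by lia⟩
  obtain ⟨C, hC⟩ := hδ
  refine ⟨fun hJ => ?_, fun hJ => ?_⟩
  · refine ⟨⟨C, hC, MultidiagCopula.entropy_eq_bot_of_J_eq_top hC hJ⟩, ?_⟩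
    rintro _ ⟨C', hC', rfl⟩
    exact (MultidiagCopula.entropy_eq_bot_of_J_eq_top hC' hJ).le
  · have hN := MultidiagCopula.chargesGaps_of_J_lt_top hC hJ
    have hQ := MultidiagCopula.maxEntCopula_mem hC hN
    have hac := MultidiagCopula.maxEntCopula_absolutelyContinuous δ
    have hent := MultidiagCopula.entropy_maxEntCopula hC hJ
    refine ⟨⟨_, hQ, hac⟩, MultidiagCopula.density_nonneg hC, hQ, hac,
      MultidiagCopula.isSymmetric_maxEntCopula hC, ?_, ⟨⟨_, hQ, rfl⟩, ?_⟩, ?_⟩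
    · rw [hent]
      exact EReal.bot_lt_coe _
    · rintro _ ⟨C', hC', rfl⟩
      rw [hent]
      exact (MultidiagCopula.entropy_le hC' hJ).1
    · intro C' hC' h
      rw [hent] at h
      exact (MultidiagCopula.entropy_le hC' hJ).2 h
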